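/- Fix an integer $d\ge 1$ and a real number $\alpha>0$, and put $\beta=2/\alpha$. For $n\ge 0$ let $\mathcal P_n(d)$ be the set of partitions $\lambda=(\lambda_1\ge\dots\ge\lambda_d\ge 0)$ of $n$ with at most $d$ nonzero parts. For $\lambda\in\mathcal P_n(d)$ with conjugate partition $\lambda'$ put $$c_\lambda(\alpha)=\prod_{(i,j)\in\lambda}\bigl(\alpha(\lambda_i-j)+(\lambda'_j-i)+1\bigr),\qquad c'_\lambda(\alpha)=\prod_{(i,j)\in\lambda}\bigl(\alpha(\lambda_i-j)+(\lambda'_j-i)+\alpha\bigr),$$ where the products run over the boxes $(i,j)$, $1\le i\le d$, $1\le j\le\lambda_i$, of the Young diagram of $\lambda$. The Jack measure restricted to $\mathcal P_n(d)$ is the probability measure $$\mathbb P^{\mathrm{Jack},\alpha}_{n,d}(\lambda)=\frac{1}{C_{n,d}(\alpha)}\,\frac{1}{c_\lambda(\alpha)c'_\lambda(\alpha)},\qquad C_{n,d}(\alpha)=\sum_{\mu\in\mathcal P_n(d)}\frac{1}{c_\mu(\alpha)c'_\mu(\alpha)}.$$ The traceless Gaussian $\beta$-ensemble is the probability measure on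 $$\mathfrak H_d=\{x\in\mathbb R^d : x_1\ge\dots\ge x_d,\ x_1+\dots+x_d=0\}$$ with density $$\frac{1}{Z_d(\beta)}\,e^{-\frac{\beta}{2}\sum_{j=1}^d x_j^2}\prod_{1\le j<k\le d}(x_j-x_k)^\beta$$ with respect to $dx_1\cdots dx_{d-1}$ (where $x_d=-(x_1+\dots+x_{d-1})$), $Z_d(\beta)$ being the normalizing constant; for $d=1$ it is the point mass at $0$. Then both of these are indeed probability measures, and if, for each $n$, $\lambda^{(n)}=(\lambda^{(n)}_1,\dots,\lambda^{(n)}_d)$ is a random element of $\mathcal P_n(d)$ with distribution $\mathbb P^{\mathrm{Jack},\alpha}_{n,d}$, and $(x_1,\dots,x_d)$ is a random vector distributed according to the traceless Gaussian $\beta$-ensemble, then, as $n\to\infty$, the random vectors $$\Bigl(\sqrt{\tfrac{\alpha d}{n}}\bigl(\lambda^{(n)}_i-\tfrac nd\bigr)\Bigr)_{1\le i\le d}$$ converge in (joint) distribution to $(x_1,\dots,x_d)$. -/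

import Mathlib

open MeasureTheory ProbabilityTheory Filter

noncomputable section

namespace JackMeasure

/-- The partitions of `n` with at most `d` nonzero parts, written as weakly decreasing sequences
`(l 0, …, l (d - 1))` of natural numbers with sum `n`. -/
def partitions (d n : ℕ) : Finset (Fin d → ℕ) :=
  {l ∈ Finset.piAntidiag Finset.univ n | ∀ i j : Fin d, i ≤ j → l j ≤ l i}

/-- The part with (zero-based) index `j` of the conjugate partition: the length of the
corresponding column of the Young diagram. -/
def conjPart {d : ℕ} (l : Fin d → ℕ) (j : ℕ) : ℕ :=
  (Finset.univ.filter fun k : Fin d => j < l k).card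

/-- The arm length of the box with zero-based row `i` and column `j`. -/
def arm {d : ℕ} (l : Fin d → ℕ) (i : Fin d) (j : ℕ) : ℝ :=
  (l i : ℝ) - ((j : ℝ) + 1)

/-- The leg length of the box with zero-based row `i` and column `j`. -/
def leg {d : ℕ} (l : Fin d → ℕ) (i : Fin d) (j : ℕ) : ℝ :=
  (conjPart l j : ℝ) - (((i : ℕ) : ℝ) + 1)

/-- The product `c_l(α)` of `α * arm + leg + 1` over the boxes of the Young diagram of `l`. -/
def hookLower {d : ℕ} (α : ℝ) (l : Fin d → ℕ) : ℝ :=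
  ∏ i : Fin d, ∏ j ∈ Finset.range (l i), (α * arm l i j + leg l i j + 1)

/-- The product `c'_l(α)` of `α * arm + leg + α` over the boxes of the Young diagram of `l`. -/
def hookUpper {d : ℕ} (α : ℝ) (l : Fin d → ℕ) : ℝ :=
  ∏ i : Fin d, ∏ j ∈ Finset.range (l i), (α * arm l i j + leg l i j + α)

/-- The normalizing constant of the restricted Jack measure. -/
def normConst (d : ℕ) (α : ℝ) (n : ℕ) : ℝ :=
  ∑ l ∈ partitions d n, 1 / (hookLower α l * hookUpper α l)

/-- The Jack probability of `l`, for the Jack measure restricted to partitions of `n` with at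
most `d` parts. -/
def prob (d : ℕ) (α : ℝ) (n : ℕ) (l : Fin d → ℕ) : ℝ :=
  1 / normConst d α n * (1 / (hookLower α l * hookUpper α l))

/-- The restricted Jack measure, as a measure on `Fin d → ℕ` carried by `partitions d n`. -/
def restricted (d : ℕ) (α : ℝ) (n : ℕ) : Measure (Fin d → ℕ) :=
  ∑ l ∈ partitions d n, ENNReal.ofReal (prob d α n l) • Measure.dirac l

/-- The rescaled parts `√(α d / n) (l i - n / d)`. -/
def rescale (d : ℕ) (α : ℝ) (n : ℕ) (l : Fin d → ℕ) : Fin d → ℝ :=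
  fun i => √(α * d / n) * ((l i : ℝ) - (n : ℝ) / d)

end JackMeasure

namespace TracelessGBE

/-- The point of the hyperplane `∑ i, x i = 0` of `ℝ ^ d` with given first `d - 1` coordinates;
the last coordinate is minus their sum. -/
def lift (d : ℕ) (y : Fin (d - 1) → ℝ) : Fin d → ℝ :=
  fun i => if h : (i : ℕ) < d - 1 then y ⟨i, h⟩ else -∑ k, y k

/-- The first `d - 1` coordinates of the points of the hyperplane with weakly decreasing
coordinates. -/
def chamber (d : ℕ) : Set (Fin (d - 1) → ℝ) :=
  {y | ∀ i j : Fin d, i ≤ j → lift d y j ≤ lift d y i}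

/-- The unnormalized density `exp (-β/2 ∑ x_j²) ∏_{j < k} (x_j - x_k) ^ β`. -/
def weight {d : ℕ} (β : ℝ) (x : Fin d → ℝ) : ℝ :=
  Real.exp (-(β / 2) * ∑ j, x j ^ 2) *
    ∏ j : Fin d, ∏ k ∈ Finset.univ.filter (fun k : Fin d => j < k), (x j - x k) ^ β

/-- The normalizing constant `Z_d(β)`, an integral with respect to `dx_1 ⋯ dx_{d-1}`. -/
def partitionFunction (d : ℕ) (β : ℝ) : ENNReal :=
  ∫⁻ y in chamber d, ENNReal.ofReal (weight β (lift d y))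

/-- The traceless Gaussian `β`-ensemble: the law on `ℝ ^ d`, carried by the weakly decreasing
points with coordinate sum `0`, with density `weight / Z_d(β)` with respect to
`dx_1 ⋯ dx_{d-1}`. -/
def law (d : ℕ) (β : ℝ) : Measure (Fin d → ℝ) :=
  ((volume.restrict (chamber d)).withDensity fun y =>
    (partitionFunction d β)⁻¹ * ENNReal.ofReal (weight β (lift d y))).map (lift d)

end TracelessGBE

end

/-!
For each `e > 0` the product over the boxes of a diagram of `α * arm + leg + e` telescopes row by
row into quotients of Gamma values. By Stirling's formula its inverse, multiplied by a factor
depending only on `n`, converges under the rescaling to the weight of the `β`-ensemble with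
parameter `1 / α`, whatever the value of `e`. The Jack measure combines `e = 1` and `e = α`, and the
two weights multiply to the one with parameter `2 / α`. The rescaled partitions form a lattice, so
that sums over them are Riemann sums on the hyperplane of traceless vectors, and an exponential
bound uniform in `n` allows dominated convergence.
-/

noncomputable section

open InformationTheory Real Topology

/-! ### Stirling asymptotics of the Gamma function at integer shifts -/

/-- The ratio of `Γ (m + a)` to its Stirling approximation `√(2π) (m / e) ^ m (m + 1) ^ (a - 1/2)`.
The power of `m + 1`, rather than `m`, keeps it positive at `m = 0`. -/
def stirlingRatio (a : ℝ) (m : ℕ) : ℝ :=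
  Gamma (m + a) / (√(2 * π) * (m / exp 1) ^ m * ((m : ℝ) + 1) ^ (a - 1 / 2))

lemma stirlingApprox_pos (a : ℝ) (m : ℕ) :
    0 < √(2 * π) * (m / exp 1) ^ m * ((m : ℝ) + 1) ^ (a - 1 / 2) := by
  have : (0 : ℝ) < (m / exp 1) ^ m := by
    rcases Nat.eq_zero_or_pos m with rfl | hm
    · simp
    · positivity
  positivity

lemma Gamma_add_pos {a : ℝ} (ha : 0 < a) (m : ℕ) : 0 < Gamma (m + a) :=
  Gamma_pos_of_pos (by positivity)

lemma stirlingRatio_pos {a : ℝ} (ha : 0 < a) (m : ℕ) : 0 < stirlingRatio a m :=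
  div_pos (Gamma_add_pos ha m) (stirlingApprox_pos a m)

lemma Gamma_add_eq_stirlingRatio_mul (a : ℝ) (m : ℕ) :
    Gamma (m + a) =
      stirlingRatio a m * (√(2 * π) * (m / exp 1) ^ m * ((m : ℝ) + 1) ^ (a - 1 / 2)) :=
  (div_mul_cancel₀ _ (stirlingApprox_pos a m).ne').symm

lemma Gamma_mul_prod_range {a : ℝ} (ha : 0 < a) (n : ℕ) :
    Gamma a * ∏ j ∈ Finset.range n, (a + j) = Gamma (n + a) := by
  induction n with
  | zero => simp
  | succ n ih =>
    rw [Finset.prod_range_succ, ← mul_assoc, ih, mul_comm, add_comm a,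
      ← Gamma_add_one (by positivity)]
    push_cast
    ring_nf

lemma tendsto_Gamma_add_div_factorial {a : ℝ} (ha : 0 < a) :
    Tendsto (fun m : ℕ => Gamma (m + a) / (m.factorial * ((m : ℝ) + 1) ^ (a - 1))) atTop (𝓝 1) := by
  rw [← tendsto_add_atTop_iff_nat 1]
  have hG : Gamma a ≠ 0 := (Gamma_pos_of_pos ha).ne'
  have hseq : Tendsto (fun n : ℕ => Gamma a / GammaSeq a n) atTop (𝓝 1) := by
    simpa only [Pi.div_def, div_self hG] using
      (tendsto_const_nhds (x := Gamma a)).div (GammaSeq_tendsto_Gamma a) hG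
  have hpow : Tendsto (fun n : ℕ => ((n : ℝ) / (n + 2)) ^ (a - 1)) atTop (𝓝 1) := by
    simpa using (tendsto_natCast_div_add_atTop (2 : ℝ)).rpow_const (p := a - 1) (by simp)
  have hlim := (hseq.mul (tendsto_natCast_div_add_atTop 1)).mul hpow
  simp only [mul_one] at hlim
  refine hlim.congr' ?_
  filter_upwards [eventually_gt_atTop 0] with n hn
  have hn' : (0 : ℝ) < n := by exact_mod_cast hn
  have : 0 < ∏ j ∈ Finset.range (n + 1), (a + j) := Finset.prod_pos fun j _ => by positivity
  rw [GammaSeq, ← Gamma_mul_prod_range ha, div_rpow (by positivity) (by positivity),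
    Nat.factorial_succ, rpow_sub_one hn'.ne']
  push_cast
  rw [show (n : ℝ) + 1 + 1 = n + 2 by ring]
  field_simp

lemma tendsto_stirlingRatio {a : ℝ} (ha : 0 < a) : Tendsto (stirlingRatio a) atTop (𝓝 1) := by
  have hfact : Tendsto (fun m : ℕ => Stirling.stirlingSeq m / √π) atTop (𝓝 1) := by
    simpa only [div_self (sqrt_pos.2 pi_pos).ne'] using
      Stirling.tendsto_stirlingSeq_sqrt_pi.div_const √π
  have hsqrt : Tendsto (fun m : ℕ => √((m : ℝ) / (m + 1))) atTop (𝓝 1) := by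
    simpa using (tendsto_natCast_div_add_atTop (1 : ℝ)).sqrt
  have hlim := ((tendsto_Gamma_add_div_factorial ha).mul hfact).mul hsqrt
  simp only [mul_one] at hlim
  refine hlim.congr' ?_
  filter_upwards [eventually_gt_atTop 0] with m hm
  have hpow : ((m : ℝ) + 1) ^ (a - 1 / 2) = ((m : ℝ) + 1) ^ (a - 1) * √((m : ℝ) + 1) := by
    rw [sqrt_eq_rpow, ← rpow_add (by positivity)]
    ring_nf
  rw [stirlingRatio, Stirling.stirlingSeq, hpow, sqrt_div (by positivity),
    sqrt_mul zero_le_two, sqrt_mul zero_le_two]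
  field_simp

lemma exists_stirlingRatio_bounds {a : ℝ} (ha : 0 < a) :
    ∃ C, 0 < C ∧ ∀ m, stirlingRatio a m ≤ C ∧ (stirlingRatio a m)⁻¹ ≤ C := by
  obtain ⟨C₁, hC₁⟩ := (tendsto_stirlingRatio ha).bddAbove_range
  obtain ⟨C₂, hC₂⟩ := ((tendsto_stirlingRatio ha).inv₀ one_ne_zero).bddAbove_range
  refine ⟨max 1 (max C₁ C₂), by positivity, fun m => ⟨?_, ?_⟩⟩
  · exact (hC₁ ⟨m, rfl⟩).trans (by simp)
  · exact (hC₂ ⟨m, rfl⟩).trans (by simp)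

/-! ### Local asymptotics of Gamma-deformed Poisson weights -/

lemma abs_klFun_one_add_sub_le {t : ℝ} (ht : |t| ≤ 1 / 2) :
    |klFun (1 + t) - t ^ 2 / 2| ≤ 4 * |t| ^ 3 := by
  have hlog : |-t + t ^ 2 / 2 + log (1 + t)| ≤ |t| ^ 3 / (1 - |t|) := by
    have h := abs_log_sub_add_sum_range_le (x := -t) (by rw [abs_neg]; linarith) 2
    simp only [Finset.sum_range_succ, Finset.sum_range_zero, abs_neg, sub_neg_eq_add] at h
    norm_num at h
    exact h
  have hdiv : |t| ^ 3 / (1 - |t|) ≤ 2 * |t| ^ 3 := by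
    rw [div_le_iff₀ (by linarith)]
    nlinarith [pow_nonneg (abs_nonneg t) 3]
  have hfactor : |1 + t| ≤ 3 / 2 := by
    rw [abs_le] at ht ⊢
    constructor <;> linarith
  calc |klFun (1 + t) - t ^ 2 / 2|
      = |(1 + t) * (-t + t ^ 2 / 2 + log (1 + t)) - t ^ 3 / 2| := by
        rw [klFun_apply]
        ring_nf
    _ ≤ |1 + t| * |-t + t ^ 2 / 2 + log (1 + t)| + |t| ^ 3 / 2 := by
        refine (abs_sub _ _).trans_eq ?_
        rw [abs_mul, abs_div, abs_pow, abs_two]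
    _ ≤ 3 / 2 * (2 * |t| ^ 3) + |t| ^ 3 / 2 := by gcongr; exact hlog.trans hdiv
    _ ≤ 4 * |t| ^ 3 := by nlinarith [pow_nonneg (abs_nonneg t) 3]

lemma sq_sqrt_sub_one_le_klFun {x : ℝ} (hx : 0 ≤ x) : (√x - 1) ^ 2 ≤ klFun x := by
  rcases hx.eq_or_lt with rfl | hx
  · simp [klFun_zero]
  have hlog : log (√x)⁻¹ ≤ (√x)⁻¹ - 1 := log_le_sub_one_of_pos (by positivity)
  rw [log_inv, log_sqrt hx.le] at hlog
  have hmul : x * -(log x / 2) ≤ √x - x := by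
    calc x * -(log x / 2) ≤ x * ((√x)⁻¹ - 1) := by gcongr
      _ = √x - x := by rw [mul_sub, ← div_eq_mul_inv, div_sqrt, mul_one]
  rw [klFun_apply]
  nlinarith [sq_sqrt hx.le]

lemma sq_sub_one_div_le_klFun {x D : ℝ} (hx : 0 ≤ x) (hxD : x ≤ D) :
    (x - 1) ^ 2 / (√D + 1) ^ 2 ≤ klFun x := by
  refine le_trans ?_ (sq_sqrt_sub_one_le_klFun hx)
  rw [div_le_iff₀ (by positivity), ← mul_pow]
  have hfactor : x - 1 = (√x - 1) * (√x + 1) := by linarith [mul_self_sqrt hx]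
  rw [hfactor, mul_pow, mul_pow]
  gcongr

/-- The Poisson weight `e ^ (-N) N ^ m / m!` with `m!` replaced by `Γ (m + a)`, normalised so as
to converge when `m` is within `O(√N)` of `N`. -/
def gammaTerm (a N : ℝ) (m : ℕ) : ℝ :=
  N ^ m * exp (-N) * √(2 * π * N) * N ^ (a - 1) / Gamma (m + a)

lemma gammaTerm_pos {a N : ℝ} (ha : 0 < a) (hN : 0 < N) (m : ℕ) : 0 < gammaTerm a N m := by
  have := Gamma_add_pos ha m
  unfold gammaTerm
  positivity

lemma pow_mul_exp_div_eq_exp_klFun {N : ℝ} (hN : 0 < N) (m : ℕ) :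
    N ^ m * exp (-N) / (m / exp 1) ^ m = exp (-(N * klFun (m / N))) := by
  rcases Nat.eq_zero_or_pos m with rfl | hm
  · simp [klFun_zero]
  have hm' : (0 : ℝ) < m := by exact_mod_cast hm
  have hexp : -(N * klFun (m / N)) = m * log N + -N - m * (log m - 1) := by
    rw [klFun_apply, log_div hm'.ne' hN.ne']
    field_simp
    ring
  rw [hexp, exp_sub, exp_add, exp_nat_mul, exp_nat_mul, exp_sub, exp_log hN, exp_log hm']

lemma gammaTerm_eq {a N : ℝ} (hN : 0 < N) (m : ℕ) :
    gammaTerm a N m =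
      (stirlingRatio a m)⁻¹ * (N / (m + 1)) ^ (a - 1 / 2) * exp (-(N * klFun (m / N))) := by
  have hpow : √N * N ^ (a - 1) = N ^ (a - 1 / 2) := by
    rw [sqrt_eq_rpow, ← rpow_add hN]
    ring_nf
  rw [gammaTerm, Gamma_add_eq_stirlingRatio_mul, ← pow_mul_exp_div_eq_exp_klFun hN,
    div_rpow hN.le (by positivity), ← hpow, sqrt_mul (by positivity)]
  field_simp

section Limit

variable {N : ℕ → ℝ} {m : ℕ → ℕ} {z : ℝ}

lemma tendsto_sub_div_of_tendsto_sub_div_sqrt (hN : Tendsto N atTop atTop)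
    (hm : Tendsto (fun n => ((m n : ℝ) - N n) / √(N n)) atTop (𝓝 z)) :
    Tendsto (fun n => ((m n : ℝ) - N n) / N n) atTop (𝓝 0) := by
  refine (hm.div_atTop (tendsto_sqrt_atTop.comp hN)).congr' ?_
  filter_upwards [hN.eventually_ge_atTop 0] with n hn
  simp only [Function.comp_apply, div_div, mul_self_sqrt hn]

lemma tendsto_div_of_tendsto_sub_div_sqrt (hN : Tendsto N atTop atTop)
    (hm : Tendsto (fun n => ((m n : ℝ) - N n) / √(N n)) atTop (𝓝 z)) :
    Tendsto (fun n => (m n : ℝ) / N n) atTop (𝓝 1) := by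
  have hlim := (tendsto_sub_div_of_tendsto_sub_div_sqrt hN hm).const_add 1
  rw [add_zero] at hlim
  refine hlim.congr' ?_
  filter_upwards [hN.eventually_gt_atTop 0] with n hn
  field_simp
  ring

lemma tendsto_atTop_of_tendsto_sub_div_sqrt (hN : Tendsto N atTop atTop)
    (hm : Tendsto (fun n => ((m n : ℝ) - N n) / √(N n)) atTop (𝓝 z)) :
    Tendsto m atTop atTop := by
  rw [← tendsto_natCast_atTop_iff (R := ℝ)]
  refine (hN.atTop_mul_pos one_pos (tendsto_div_of_tendsto_sub_div_sqrt hN hm)).congr' ?_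
  filter_upwards [hN.eventually_gt_atTop 0] with n hn
  field_simp

lemma tendsto_mul_klFun (hN : Tendsto N atTop atTop)
    (hm : Tendsto (fun n => ((m n : ℝ) - N n) / √(N n)) atTop (𝓝 z)) :
    Tendsto (fun n => N n * klFun (m n / N n)) atTop (𝓝 (z ^ 2 / 2)) := by
  set t : ℕ → ℝ := fun n => ((m n : ℝ) - N n) / N n with ht
  have ht0 : Tendsto t atTop (𝓝 0) := tendsto_sub_div_of_tendsto_sub_div_sqrt hN hm
  have hsq : Tendsto (fun n => N n * t n ^ 2) atTop (𝓝 (z ^ 2)) := by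
    refine (hm.pow 2).congr' ?_
    filter_upwards [hN.eventually_gt_atTop 0] with n hn
    simp only [ht, div_pow, sq_sqrt hn.le]
    field_simp
  have herror : Tendsto (fun n => N n * klFun (m n / N n) - N n * t n ^ 2 / 2) atTop (𝓝 0) := by
    have hbound : Tendsto (fun n => 4 * (N n * t n ^ 2) * |t n|) atTop (𝓝 0) := by
      simpa using (hsq.const_mul 4).mul ht0.abs
    have hsmall : ∀ᶠ n in atTop, |t n| ≤ 1 / 2 :=
      (abs_zero (α := ℝ) ▸ ht0.abs).eventually_le_const (by norm_num)
    refine squeeze_zero_norm' ?_ hbound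
    filter_upwards [hN.eventually_gt_atTop 0, hsmall] with n hn hs
    have hmN : (m n : ℝ) / N n = 1 + t n := by
      simp only [ht]
      field_simp
      ring
    calc ‖N n * klFun (m n / N n) - N n * t n ^ 2 / 2‖
        = N n * |klFun (1 + t n) - t n ^ 2 / 2| := by
          rw [norm_eq_abs, hmN, mul_div_assoc, ← mul_sub, abs_mul, abs_of_pos hn]
      _ ≤ N n * (4 * |t n| ^ 3) := by gcongr; exact abs_klFun_one_add_sub_le hs
      _ = 4 * (N n * t n ^ 2) * |t n| := by rw [pow_succ, sq_abs]; ring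
  simpa using herror.add (hsq.div_const 2)

lemma tendsto_gammaTerm {a : ℝ} (ha : 0 < a) (hN : Tendsto N atTop atTop)
    (hm : Tendsto (fun n => ((m n : ℝ) - N n) / √(N n)) atTop (𝓝 z)) :
    Tendsto (fun n => gammaTerm a (N n) (m n)) atTop (𝓝 (exp (-(z ^ 2 / 2)))) := by
  have hratio := ((tendsto_stirlingRatio ha).comp
    (tendsto_atTop_of_tendsto_sub_div_sqrt hN hm)).inv₀ one_ne_zero
  have hpow : Tendsto (fun n => (N n / (m n + 1)) ^ (a - 1 / 2)) atTop (𝓝 1) := by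
    have hsucc := (tendsto_div_of_tendsto_sub_div_sqrt hN hm).add (tendsto_inv_atTop_zero.comp hN)
    rw [add_zero] at hsucc
    have hlim := (hsucc.inv₀ one_ne_zero).rpow_const (p := a - 1 / 2) (by simp)
    simp only [inv_one, one_rpow] at hlim
    refine hlim.congr fun n => ?_
    rw [Function.comp_apply, ← one_div, ← one_div (N n), ← add_div, one_div_div]
  have hlim := (hratio.mul hpow).mul (tendsto_mul_klFun hN hm).neg.rexp
  simp only [inv_one, one_mul] at hlim
  refine hlim.congr' ?_
  filter_upwards [hN.eventually_gt_atTop 0] with n hn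
  exact (gammaTerm_eq hn _).symm

end Limit

lemma rpow_le_rpow_abs {u W : ℝ} (hu : 0 < u) (huW : u ≤ W) (huW' : u⁻¹ ≤ W) (p : ℝ) :
    u ^ p ≤ W ^ |p| := by
  rcases le_total 0 p with hp | hp
  · rw [abs_of_nonneg hp]
    gcongr
  · rw [abs_of_nonpos hp, ← neg_neg p, rpow_neg hu.le, neg_neg, ← inv_rpow hu.le]
    exact rpow_le_rpow (by positivity) huW' (by linarith)

lemma mul_sub_mul_sq_le {c : ℝ} (hc : 0 < c) (b t : ℝ) :
    b * t - c * t ^ 2 ≤ b ^ 2 / (4 * c) := by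
  rw [le_div_iff₀ (by positivity)]
  nlinarith [sq_nonneg (2 * c * t - b)]

lemma one_add_sq_le_exp_two_mul_abs (t : ℝ) : 1 + t ^ 2 ≤ exp (2 * |t|) := by
  have h := pow_le_pow_left₀ (by positivity) (add_one_le_exp |t|) 2
  rw [← exp_nat_mul, Nat.cast_ofNat] at h
  nlinarith [sq_abs t, abs_nonneg t]

section Bound

variable {D N : ℝ} {m : ℕ}

lemma div_succ_le_exp (hN : 0 < N) :
    N / (m + 1) ≤ 4 * exp (2 * |((m : ℝ) - N) / √N|) := by
  set z := ((m : ℝ) - N) / √N with hz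
  have hzN : z ^ 2 * N = (m - N) ^ 2 := by
    rw [hz, div_pow, sq_sqrt hN.le, div_mul_cancel₀ _ hN.ne']
  have hcases : N ≤ 2 * m ∨ N ≤ 4 * z ^ 2 := by
    refine (le_total N (2 * m)).imp_right fun h => le_of_mul_le_mul_right ?_ hN
    nlinarith
  have hm : (0 : ℝ) ≤ m := by positivity
  calc N / (m + 1) ≤ 4 * (1 + z ^ 2) := by
        rw [div_le_iff₀ (by positivity)]
        rcases hcases with h | h <;> nlinarith [mul_nonneg (sq_nonneg z) hm]
    _ ≤ 4 * exp (2 * |z|) := by gcongr; exact one_add_sq_le_exp_two_mul_abs z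

lemma div_succ_rpow_le (hD : 1 ≤ D) (hDN : 1 ≤ D * N) (hm : m ≤ D * N) (p : ℝ) :
    (N / (m + 1)) ^ p ≤ (4 * D) ^ |p| * exp (2 * |p| * |((m : ℝ) - N) / √N|) := by
  have hN : 0 < N := by
    by_contra! h
    nlinarith
  set z := ((m : ℝ) - N) / √N
  have hexp : 1 ≤ exp (2 * |z|) := one_le_exp (by positivity)
  have hupper : N / (m + 1) ≤ 4 * D * exp (2 * |z|) :=
    (div_succ_le_exp hN).trans (by gcongr; linarith)
  have hlower : (N / (m + 1))⁻¹ ≤ 4 * D * exp (2 * |z|) := by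
    rw [inv_div, div_le_iff₀ hN]
    nlinarith
  calc (N / (m + 1)) ^ p ≤ (4 * D * exp (2 * |z|)) ^ |p| :=
        rpow_le_rpow_abs (by positivity) hupper hlower p
    _ = (4 * D) ^ |p| * exp (2 * |p| * |z|) := by
        rw [mul_rpow (by positivity) (by positivity), ← exp_mul]
        ring_nf

lemma sq_div_le_mul_klFun (hN : 0 < N) (hm : m ≤ D * N) :
    (√D + 1)⁻¹ ^ 2 * (((m : ℝ) - N) / √N) ^ 2 ≤ N * klFun (m / N) := by
  calc (√D + 1)⁻¹ ^ 2 * (((m : ℝ) - N) / √N) ^ 2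
      = N * ((m / N - 1) ^ 2 / (√D + 1) ^ 2) := by
        rw [div_pow, sq_sqrt hN.le]
        field_simp
    _ ≤ N * klFun (m / N) := by
        gcongr
        exact sq_sub_one_div_le_klFun (by positivity) ((div_le_iff₀ hN).2 hm)

end Bound

lemma exists_gammaTerm_le {a D : ℝ} (ha : 0 < a) (hD : 1 ≤ D) (M : ℝ) :
    ∃ C, 0 < C ∧ ∀ (N : ℝ) (m : ℕ), 1 ≤ D * N → m ≤ D * N →
      gammaTerm a N m ≤ C * exp (-(M * |((m : ℝ) - N) / √N|)) := by
  obtain ⟨C, hC, hratio⟩ := exists_stirlingRatio_bounds ha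
  set p := a - 1 / 2
  set c := (√D + 1)⁻¹ ^ 2
  have hc0 : 0 < c := by positivity
  refine ⟨C * (4 * D) ^ |p| * exp ((M + 2 * |p|) ^ 2 / (4 * c)), by positivity,
    fun N m hDN hm => ?_⟩
  have hN : 0 < N := by
    by_contra! h
    nlinarith
  have := stirlingRatio_pos ha m
  set z := ((m : ℝ) - N) / √N
  have hsquare := mul_sub_mul_sq_le hc0 (M + 2 * |p|) |z|
  rw [sq_abs] at hsquare
  rw [gammaTerm_eq hN]
  calc _ ≤ C * ((4 * D) ^ |p| * exp (2 * |p| * |z|)) * exp (-(c * z ^ 2)) := by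
        gcongr ?_ * ?_ * exp (-?_)
        · exact (hratio m).2
        · exact div_succ_rpow_le hD hDN hm p
        · exact sq_div_le_mul_klFun hN hm
    _ = C * (4 * D) ^ |p| * exp (2 * |p| * |z| - c * z ^ 2) := by
        rw [sub_eq_add_neg, exp_add]
        ring
    _ ≤ C * (4 * D) ^ |p| * exp ((M + 2 * |p|) ^ 2 / (4 * c) + -(M * |z|)) := by
        gcongr
        linarith
    _ = _ := by rw [exp_add, ← mul_assoc]

/-! ### Quotients of Gamma values at integer shifts -/

/-- The quotient `Γ (m + b + c) / Γ (m + b)`, normalised so as to converge to `z ^ c` when `s → 0`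
and `s * m → z`. -/
def gammaQuotient (b c s : ℝ) (m : ℕ) : ℝ :=
  s ^ c * (Gamma (m + (b + c)) / Gamma (m + b))

lemma gammaQuotient_nonneg {b c s : ℝ} (hb : 0 < b) (hbc : 0 < b + c) (hs : 0 ≤ s) (m : ℕ) :
    0 ≤ gammaQuotient b c s m :=
  mul_nonneg (rpow_nonneg hs c) (div_pos (Gamma_add_pos hbc m) (Gamma_add_pos hb m)).le

lemma gammaQuotient_eq (b c : ℝ) {s : ℝ} (hs : 0 ≤ s) (m : ℕ) :
    gammaQuotient b c s m =
      (s * (m + 1)) ^ c * (stirlingRatio (b + c) m * (stirlingRatio b m)⁻¹) := by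
  have hpow : ((m : ℝ) + 1) ^ (b + c - 1 / 2) =
      ((m : ℝ) + 1) ^ c * ((m : ℝ) + 1) ^ (b - 1 / 2) := by
    rw [← rpow_add (by positivity)]
    ring_nf
  have := (stirlingApprox_pos b m).ne'
  rw [gammaQuotient, mul_rpow hs (by positivity), Gamma_add_eq_stirlingRatio_mul,
    Gamma_add_eq_stirlingRatio_mul b, hpow]
  field_simp

lemma tendsto_gammaQuotient {ι : Type*} {f : Filter ι} {b c z : ℝ} (hb : 0 < b)
    (hbc : 0 < b + c) {s : ι → ℝ} {m : ι → ℕ} (hs : ∀ n, 0 ≤ s n) (hs0 : Tendsto s f (𝓝 0))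
    (hm : Tendsto (fun n => s n * m n) f (𝓝 z)) (hz : 0 < z) :
    Tendsto (fun n => gammaQuotient b c (s n) (m n)) f (𝓝 (z ^ c)) := by
  have hm_atTop : Tendsto m f atTop := by
    have hs_pos : ∀ᶠ n in f, 0 < s n := by
      filter_upwards [hm.eventually_const_lt hz] with n hn
      exact pos_of_mul_pos_left hn (Nat.cast_nonneg _)
    have hs_inv := tendsto_inv_nhdsGT_zero.comp (tendsto_nhdsWithin_iff.2 ⟨hs0, hs_pos⟩)
    rw [← tendsto_natCast_atTop_iff (R := ℝ)]
    refine (hm.pos_mul_atTop hz hs_inv).congr' ?_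
    filter_upwards [hs_pos] with n hn
    rw [Function.comp_apply, mul_right_comm, mul_inv_cancel₀ hn.ne', one_mul]
  have hpow : Tendsto (fun n => (s n * (m n + 1)) ^ c) f (𝓝 (z ^ c)) := by
    have h := hm.add hs0
    rw [add_zero] at h
    simpa only [mul_add, mul_one] using h.rpow_const (Or.inl hz.ne')
  have hratio := ((tendsto_stirlingRatio hbc).mul
    ((tendsto_stirlingRatio hb).inv₀ one_ne_zero)).comp hm_atTop
  have hlim := hpow.mul hratio
  simp only [inv_one, mul_one] at hlim
  refine hlim.congr fun n => ?_
  rw [gammaQuotient_eq b c (hs n), Function.comp_apply]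

lemma rpow_le_exp_mul {u c : ℝ} (hu : 0 ≤ u) (hc : 0 ≤ c) : u ^ c ≤ exp (c * u) := by
  rw [mul_comm, exp_mul]
  exact rpow_le_rpow hu (by linarith [add_one_le_exp u]) hc

lemma exists_gammaQuotient_le {b c : ℝ} (hb : 0 < b) (hc : 0 ≤ c) (S : ℝ) :
    ∃ C, 0 < C ∧ ∀ (s : ℝ) (m : ℕ), 0 ≤ s → s ≤ S →
      gammaQuotient b c s m ≤ C * exp (c * (s * m)) := by
  obtain ⟨C₁, hC₁, hnum⟩ := exists_stirlingRatio_bounds (add_pos_of_pos_of_nonneg hb hc)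
  obtain ⟨C₂, hC₂, hden⟩ := exists_stirlingRatio_bounds hb
  refine ⟨exp (c * S) * (C₁ * C₂), by positivity, fun s m hs hsS => ?_⟩
  have hnum_pos := stirlingRatio_pos (add_pos_of_pos_of_nonneg hb hc) m
  have hden_pos := stirlingRatio_pos hb m
  have hpow : (s * (m + 1)) ^ c ≤ exp (c * S) * exp (c * (s * m)) := by
    refine (rpow_le_exp_mul (by positivity) hc).trans ?_
    rw [← exp_add]
    gcongr
    linarith [mul_le_mul_of_nonneg_left hsS hc]
  calc gammaQuotient b c s m
      = (s * (m + 1)) ^ c * (stirlingRatio (b + c) m * (stirlingRatio b m)⁻¹) :=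
        gammaQuotient_eq b c hs m
    _ ≤ exp (c * S) * exp (c * (s * m)) * (C₁ * C₂) := by
        gcongr
        · exact (hnum m).1
        · exact (hden m).2
    _ = _ := by ring

namespace JackMeasure

/-! ### Hook products as products of Gamma values -/

lemma mem_partitions {d n : ℕ} {l : Fin d → ℕ} :
    l ∈ partitions d n ↔ ∑ i, l i = n ∧ Antitone l := by
  simp [partitions, Antitone]

/-- The product of `α * arm + leg + e` over the boxes of `l`: the common form of `hookLower α`
(`e = 1`) and `hookUpper α` (`e = α`). -/
def hookProd {d : ℕ} (α e : ℝ) (l : Fin d → ℕ) : ℝ :=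
  ∏ i : Fin d, ∏ j ∈ Finset.range (l i), (α * arm l i j + leg l i j + e)

lemma hookLower_eq {d : ℕ} (α : ℝ) (l : Fin d → ℕ) : hookLower α l = hookProd α 1 l := rfl

lemma hookUpper_eq {d : ℕ} (α : ℝ) (l : Fin d → ℕ) : hookUpper α l = hookProd α α l := rfl

lemma arm_nonneg {d : ℕ} {l : Fin d → ℕ} {i : Fin d} {j : ℕ} (hj : j < l i) : 0 ≤ arm l i j := by
  rw [arm, sub_nonneg]
  exact_mod_cast hj

lemma leg_nonneg {d : ℕ} {l : Fin d → ℕ} (hl : Antitone l) {i : Fin d} {j : ℕ} (hj : j < l i) :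
    0 ≤ leg l i j := by
  have hcard : i + 1 ≤ conjPart l j := by
    rw [← Fin.card_Iic]
    exact Finset.card_le_card fun k hk => by
      simpa using hj.trans_le (hl (Finset.mem_Iic.1 hk))
  rw [leg, sub_nonneg]
  exact_mod_cast hcard

lemma hookProd_pos {d : ℕ} {α e : ℝ} (hα : 0 ≤ α) (he : 0 < e) {l : Fin d → ℕ}
    (hl : Antitone l) : 0 < hookProd α e l :=
  Finset.prod_pos fun i _ => Finset.prod_pos fun j hj => by
    have harm := arm_nonneg (Finset.mem_range.1 hj)
    have hleg := leg_nonneg hl (Finset.mem_range.1 hj)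
    positivity

lemma prod_Ico_mul_sub_eq_Gamma_div (α : ℝ) {q : ℝ} (hq : 0 < q) {A B L : ℕ} (hBA : B ≤ A)
    (hAL : A ≤ L) :
    ∏ j ∈ Finset.Ico B A, (α * ((L : ℝ) - ((j : ℝ) + 1) + q)) =
      α ^ (A - B) * (Gamma ((L - B : ℕ) + q) / Gamma ((L - A : ℕ) + q)) := by
  have hpos : (0 : ℝ) < (L - A : ℕ) + q := by positivity
  have hGamma := Gamma_mul_prod_range hpos (A - B)
  rw [← add_assoc, ← Nat.cast_add, show A - B + (L - A) = L - B by omega] at hGamma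
  rw [Finset.prod_mul_distrib, Finset.prod_const, Nat.card_Ico, ← hGamma,
    mul_div_cancel_left₀ _ (Gamma_pos_of_pos hpos).ne', Finset.prod_Ico_eq_prod_range,
    ← Finset.prod_range_reflect]
  congr 1
  refine Finset.prod_congr rfl fun j hj => ?_
  rw [Finset.mem_range] at hj
  have hcast : ((B + (A - B - 1 - j) : ℕ) : ℝ) + 1 + j = A := by
    norm_cast
    omega
  rw [Nat.cast_sub hAL, ← hcast]
  ring

/-- The Gamma parameter `(k - i - 1 + e) / α` at which rows `i < k` interact in `hookProd α e`. -/
def hookShift (α e : ℝ) (i k : ℕ) : ℝ := ((k : ℝ) - i - 1 + e) / α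

lemma hookShift_pos {α e : ℝ} (hα : 0 < α) (he : 0 < e) {i k : ℕ} (hik : i < k) :
    0 < hookShift α e i k := by
  have hk : (i : ℝ) + 1 ≤ k := by exact_mod_cast hik
  exact div_pos (by linarith) hα

lemma hookShift_add_inv (α e : ℝ) (i k : ℕ) :
    hookShift α e i k + α⁻¹ = hookShift α e i (k + 1) := by
  rw [hookShift, hookShift, ← one_div, ← add_div]
  push_cast
  ring

lemma prod_row_eq_Gamma {α e : ℝ} (hα : 0 < α) (he : 0 < e) {lam c : ℕ → ℕ} (hlam : Antitone lam)
    {i K : ℕ} (hiK : i + 1 ≤ K)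
    (hc : ∀ k < K, ∀ j ∈ Finset.Ico (lam (k + 1)) (lam k), c j = k + 1) :
    ∏ j ∈ Finset.Ico (lam K) (lam i),
        (α * ((lam i : ℝ) - ((j : ℝ) + 1)) + ((c j : ℝ) - ((i : ℝ) + 1)) + e) =
      α ^ (lam i - lam K) *
        (Gamma ((lam i - lam K : ℕ) + hookShift α e i K) / Gamma (e / α)) *
        ∏ k ∈ Finset.Ico (i + 1) K, Gamma ((lam i - lam k : ℕ) + hookShift α e i k) /
          Gamma ((lam i - lam k : ℕ) + (hookShift α e i k + α⁻¹)) := by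
  have hblock : ∀ k < K, i ≤ k → ∏ j ∈ Finset.Ico (lam (k + 1)) (lam k),
        (α * ((lam i : ℝ) - ((j : ℝ) + 1)) + ((c j : ℝ) - ((i : ℝ) + 1)) + e) =
      α ^ (lam k - lam (k + 1)) * (Gamma ((lam i - lam (k + 1) : ℕ) + hookShift α e i (k + 1)) /
        Gamma ((lam i - lam k : ℕ) + hookShift α e i (k + 1))) := by
    intro k hk hik
    rw [← prod_Ico_mul_sub_eq_Gamma_div α (hookShift_pos hα he (Nat.lt_succ_of_le hik))
      (hlam k.le_succ) (hlam hik)]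
    refine Finset.prod_congr rfl fun j hj => ?_
    rw [hc k hk j hj, hookShift]
    push_cast
    field_simp
    ring
  induction K, hiK using Nat.le_induction with
  | base => simpa [hookShift] using hblock i i.lt_succ_self le_rfl
  | succ K hiK ih =>
    have hK : lam (K + 1) ≤ lam K := hlam K.le_succ
    have hKi : lam K ≤ lam i := hlam (by omega)
    rw [← Finset.prod_Ico_consecutive _ hK hKi, hblock K K.lt_succ_self (by omega),
      ih (fun k hk => hc k (by omega)) (fun k hk => hblock k (by omega)),
      Finset.prod_Ico_succ_top hiK, hookShift_add_inv,
      show lam i - lam (K + 1) = (lam K - lam (K + 1)) + (lam i - lam K) by omega, pow_add]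
    ring

/-- The rows of `l`, continued by zero. -/
def padZero {d : ℕ} (l : Fin d → ℕ) (k : ℕ) : ℕ := if h : k < d then l ⟨k, h⟩ else 0

lemma padZero_coe {d : ℕ} (l : Fin d → ℕ) (k : Fin d) : padZero l k = l k := by
  simp [padZero]

lemma antitone_padZero {d : ℕ} {l : Fin d → ℕ} (hl : Antitone l) : Antitone (padZero l) := by
  intro j k hjk
  unfold padZero
  split_ifs with hk hj
  · exact hl hjk
  · omega
  · exact Nat.zero_le _
  · exact le_rfl

lemma conjPart_eq {d : ℕ} {l : Fin d → ℕ} (hl : Antitone l) {k j : ℕ} (hk : k < d)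
    (hj : j ∈ Finset.Ico (padZero l (k + 1)) (padZero l k)) : conjPart l j = k + 1 := by
  rw [Finset.mem_Ico] at hj
  have hrows : (Finset.univ.filter fun x : Fin d => j < l x) = Finset.Iic ⟨k, hk⟩ := by
    ext x
    simp only [Finset.mem_filter, Finset.mem_univ, true_and, Finset.mem_Iic, Fin.le_def,
      ← padZero_coe l x]
    refine ⟨fun hx => ?_, fun hx => hj.2.trans_le (antitone_padZero hl hx)⟩
    by_contra! hkx
    exact (hj.1.trans_lt hx).not_ge (antitone_padZero hl hkx)
  rw [conjPart, hrows, Fin.card_Iic]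

lemma hookProd_eq_Gamma {d : ℕ} {α e : ℝ} (hα : 0 < α) (he : 0 < e) {l : Fin d → ℕ}
    (hl : Antitone l) :
    hookProd α e l = ∏ i : Fin d, α ^ l i * (Gamma (l i + hookShift α e i d) / Gamma (e / α)) *
        ∏ k ∈ Finset.Ioi i, Gamma ((l i - l k : ℕ) + hookShift α e i k) /
          Gamma ((l i - l k : ℕ) + (hookShift α e i k + α⁻¹)) := by
  refine Finset.prod_congr rfl fun i _ => ?_
  have hrow := prod_row_eq_Gamma hα he (antitone_padZero hl) i.isLt fun k hk j hj =>
    conjPart_eq hl hk hj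
  have hd : padZero l d = 0 := by simp [padZero]
  have hIoi : Finset.Ico (i + 1 : ℕ) d = (Finset.Ioi i).map Fin.valEmbedding :=
    (Finset.Ico_succ_left_eq_Ioo (i : ℕ) d).trans (Fin.map_valEmbedding_Ioi i).symm
  rw [hd, padZero_coe, Nat.sub_zero, Nat.Ico_zero_eq_range, hIoi, Finset.prod_map] at hrow
  simpa only [Fin.valEmbedding_apply, padZero_coe, arm, leg] using hrow

end JackMeasure

namespace TracelessGBE

/-! ### The weight of the Gaussian ensemble -/

lemma weight_eq_prod_Ioi {d : ℕ} (β : ℝ) (x : Fin d → ℝ) :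
    weight β x = exp (-(β / 2) * ∑ j, x j ^ 2) *
      ∏ j : Fin d, ∏ k ∈ Finset.Ioi j, (x j - x k) ^ β := by
  simp only [weight, Finset.filter_lt_eq_Ioi]

lemma weight_nonneg {d : ℕ} (β : ℝ) {x : Fin d → ℝ} (hx : Antitone x) : 0 ≤ weight β x := by
  rw [weight_eq_prod_Ioi]
  exact mul_nonneg (exp_pos _).le (Finset.prod_nonneg fun j _ => Finset.prod_nonneg fun k hk =>
    rpow_nonneg (sub_nonneg.2 (hx (Finset.mem_Ioi.1 hk).le)) _)

lemma weight_pos {d : ℕ} (β : ℝ) {x : Fin d → ℝ} (hx : StrictAnti x) : 0 < weight β x := by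
  rw [weight_eq_prod_Ioi]
  exact mul_pos (exp_pos _) (Finset.prod_pos fun j _ => Finset.prod_pos fun k hk =>
    rpow_pos_of_pos (sub_pos.2 (hx (Finset.mem_Ioi.1 hk))) _)

lemma weight_add {d : ℕ} (β γ : ℝ) {x : Fin d → ℝ} (hx : StrictAnti x) :
    weight (β + γ) x = weight β x * weight γ x := by
  have hprod : ∏ j, ∏ k ∈ Finset.Ioi j, (x j - x k) ^ (β + γ) =
      (∏ j, ∏ k ∈ Finset.Ioi j, (x j - x k) ^ β) * ∏ j, ∏ k ∈ Finset.Ioi j, (x j - x k) ^ γ := by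
    simp only [← Finset.prod_mul_distrib]
    exact Finset.prod_congr rfl fun j _ => Finset.prod_congr rfl fun k hk =>
      rpow_add (sub_pos.2 (hx (Finset.mem_Ioi.1 hk))) β γ
  simp only [weight_eq_prod_Ioi, hprod]
  rw [mul_mul_mul_comm, ← exp_add]
  ring_nf

lemma sum_sum_Ioi_sub_le {d : ℕ} (x : Fin d → ℝ) :
    ∑ j, ∑ k ∈ Finset.Ioi j, (x j - x k) ≤ 2 * d * ∑ j, |x j| := by
  calc ∑ j, ∑ k ∈ Finset.Ioi j, (x j - x k)
      ≤ ∑ j, ∑ k ∈ Finset.Ioi j, (|x j| + |x k|) := by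
        gcongr with j _ k _
        linarith [le_abs_self (x j), neg_abs_le (x k)]
    _ ≤ ∑ j : Fin d, ∑ k : Fin d, (|x j| + |x k|) := by
        gcongr with j
        exact Finset.subset_univ _
    _ = 2 * d * ∑ j, |x j| := by
        simp only [Finset.sum_add_distrib, Finset.sum_const, Finset.card_univ, Fintype.card_fin,
          nsmul_eq_mul, ← Finset.mul_sum]
        ring

lemma exists_weight_le {β : ℝ} (hβ : 0 < β) (d : ℕ) :
    ∃ C, 0 < C ∧ ∀ x : Fin d → ℝ, Antitone x → weight β x ≤ C * exp (-∑ j, |x j|) := by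
  obtain ⟨b, hb⟩ : ∃ b : ℝ, b = 2 * d * β + 1 := ⟨_, rfl⟩
  refine ⟨exp (d * (b ^ 2 / (4 * (β / 2)))), exp_pos _, fun x hx => ?_⟩
  have hsub : ∀ j, ∀ k ∈ Finset.Ioi j, 0 ≤ x j - x k := fun j k hk =>
    sub_nonneg.2 (hx (Finset.mem_Ioi.1 hk).le)
  have hprod : ∏ j, ∏ k ∈ Finset.Ioi j, (x j - x k) ^ β ≤ exp (β * (2 * d * ∑ j, |x j|)) := by
    calc ∏ j, ∏ k ∈ Finset.Ioi j, (x j - x k) ^ β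
        ≤ ∏ j, ∏ k ∈ Finset.Ioi j, exp (β * (x j - x k)) :=
          Finset.prod_le_prod
            (fun j _ => Finset.prod_nonneg fun k hk => rpow_nonneg (hsub j k hk) _) fun j _ =>
            Finset.prod_le_prod (fun k hk => rpow_nonneg (hsub j k hk) _) fun k hk =>
              rpow_le_exp_mul (hsub j k hk) hβ.le
      _ = exp (β * ∑ j, ∑ k ∈ Finset.Ioi j, (x j - x k)) := by
          simp only [Finset.mul_sum, exp_sum]
      _ ≤ exp (β * (2 * d * ∑ j, |x j|)) := by
          gcongr
          exact sum_sum_Ioi_sub_le x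
  have hsquares : b * ∑ j, |x j| - β / 2 * ∑ j, x j ^ 2 ≤ d * (b ^ 2 / (4 * (β / 2))) := by
    have hsum := Finset.sum_le_sum fun j (_ : j ∈ Finset.univ) =>
      mul_sub_mul_sq_le (half_pos hβ) b |x j|
    simpa [Finset.sum_sub_distrib, ← Finset.mul_sum] using hsum
  calc weight β x ≤ exp (-(β / 2) * ∑ j, x j ^ 2) * exp (β * (2 * d * ∑ j, |x j|)) := by
        rw [weight_eq_prod_Ioi]
        gcongr
    _ ≤ exp (d * (b ^ 2 / (4 * (β / 2)))) * exp (-∑ j, |x j|) := by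
        rw [← exp_add, ← exp_add]
        refine exp_le_exp.2 ?_
        rw [hb] at hsquares ⊢
        linarith

end TracelessGBE

namespace JackMeasure

/-! ### Local limits of the hook products -/

/-- The factor `√(α d / n)` by which `rescale` contracts the integer lattice. -/
def mesh (d : ℕ) (α : ℝ) (n : ℕ) : ℝ := √(α * d / n)

lemma mesh_nonneg (d : ℕ) (α : ℝ) (n : ℕ) : 0 ≤ mesh d α n := sqrt_nonneg _

lemma mesh_pos {d n : ℕ} {α : ℝ} (hα : 0 < α) (hd : 0 < d) (hn : 0 < n) : 0 < mesh d α n := by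
  unfold mesh
  positivity

lemma mesh_le {d n : ℕ} {α : ℝ} (hα : 0 ≤ α) (hn : 0 < n) : mesh d α n ≤ √(α * d) :=
  sqrt_le_sqrt (div_le_self (by positivity) (by exact_mod_cast hn))

lemma tendsto_mesh (d : ℕ) (α : ℝ) : Tendsto (mesh d α) atTop (𝓝 0) := by
  have hlim := (tendsto_const_div_atTop_nhds_zero_nat (α * d)).sqrt
  rwa [sqrt_zero] at hlim

lemma mesh_eq {α : ℝ} (hα : 0 ≤ α) (d n : ℕ) : mesh d α n = √α / √((n : ℝ) / d) := by
  rw [mesh, ← sqrt_div hα, div_div_eq_mul_div]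

lemma sub_div_sqrt_eq_rescale_div {d n : ℕ} {α : ℝ} (hα : 0 < α) (l : Fin d → ℕ) (i : Fin d) :
    ((l i : ℝ) - n / d) / √((n : ℝ) / d) = rescale d α n l i / √α := by
  have hsqrt : √α ≠ 0 := (sqrt_pos.2 hα).ne'
  rw [rescale, ← mesh, mesh_eq hα.le]
  field_simp

lemma mesh_mul_sub {d n : ℕ} {α : ℝ} {l : Fin d → ℕ} (hl : Antitone l) {i k : Fin d}
    (hik : i ≤ k) :
    mesh d α n * (l i - l k : ℕ) = rescale d α n l i - rescale d α n l k := by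
  rw [Nat.cast_sub (hl hik), rescale, rescale, mesh]
  ring

lemma antitone_rescale {d : ℕ} (α : ℝ) (n : ℕ) {l : Fin d → ℕ} (hl : Antitone l) :
    Antitone (rescale d α n l) := fun i j hij => by
  have hlij : (l j : ℝ) ≤ l i := by exact_mod_cast hl hij
  unfold rescale
  gcongr

/-- The inverse of `hookProd α e l`, up to a factor depending only on `n`: the normalisation for
which it converges to the weight of the Gaussian ensemble with parameter `1 / α`. -/
def hookWeight {d : ℕ} (α e : ℝ) (n : ℕ) (l : Fin d → ℕ) : ℝ :=
  ∏ i : Fin d, gammaTerm (hookShift α e i d) (n / d) (l i) *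
    ∏ k ∈ Finset.Ioi i, gammaQuotient (hookShift α e i k) α⁻¹ (mesh d α n) (l i - l k)

/-- The constant relating row `i` of `hookWeight` and of `hookProd`. -/
def hookConst {d : ℕ} (α e : ℝ) (n : ℕ) (i : Fin d) : ℝ :=
  exp (-(n / d)) * √(2 * π * (n / d)) * ((n : ℝ) / d) ^ (hookShift α e i d - 1) *
    (Gamma (e / α))⁻¹ * ∏ _k ∈ Finset.Ioi i, mesh d α n ^ α⁻¹

lemma hookConst_pos {d n : ℕ} {α e : ℝ} (hα : 0 < α) (he : 0 < e) (hn : 0 < n) (i : Fin d) :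
    0 < hookConst α e n i := by
  have hd : 0 < d := i.pos
  have hmesh := mesh_pos hα hd hn
  have : 0 < Gamma (e / α) := Gamma_pos_of_pos (div_pos he hα)
  unfold hookConst
  positivity

lemma prod_gammaQuotient_nonneg {d : ℕ} {α e : ℝ} (hα : 0 < α) (he : 0 < e) (n : ℕ)
    (l : Fin d → ℕ) (i : Fin d) :
    0 ≤ ∏ k ∈ Finset.Ioi i,
      gammaQuotient (hookShift α e i k) α⁻¹ (mesh d α n) (l i - l k) :=
  Finset.prod_nonneg fun k hk => by
    have hshift := hookShift_pos hα he (Fin.lt_def.1 (Finset.mem_Ioi.1 hk))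
    exact gammaQuotient_nonneg hshift (by positivity) (mesh_nonneg d α n) _

lemma hookWeight_nonneg {d n : ℕ} {α e : ℝ} (hα : 0 < α) (he : 0 < e) (hn : 0 < n)
    (l : Fin d → ℕ) : 0 ≤ hookWeight α e n l :=
  Finset.prod_nonneg fun i _ => by
    have hd : (0 : ℝ) < d := by exact_mod_cast i.pos
    exact mul_nonneg (gammaTerm_pos (hookShift_pos hα he i.isLt) (by positivity) _).le
      (prod_gammaQuotient_nonneg hα he n l i)

lemma hookWeight_mul_hookProd {d : ℕ} {α e : ℝ} (hα : 0 < α) (he : 0 < e) (n : ℕ)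
    {l : Fin d → ℕ} (hl : Antitone l) :
    hookWeight α e n l * hookProd α e l = ∏ i, hookConst α e n i * (α * (n / d)) ^ l i := by
  rw [hookProd_eq_Gamma hα he hl, hookWeight, ← Finset.prod_mul_distrib]
  refine Finset.prod_congr rfl fun i _ => ?_
  have hpairs : ∏ k ∈ Finset.Ioi i,
        gammaQuotient (hookShift α e i k) α⁻¹ (mesh d α n) (l i - l k) =
      (∏ _k ∈ Finset.Ioi i, mesh d α n ^ α⁻¹) *
        (∏ k ∈ Finset.Ioi i, Gamma ((l i - l k : ℕ) + hookShift α e i k) /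
          Gamma ((l i - l k : ℕ) + (hookShift α e i k + α⁻¹)))⁻¹ := by
    rw [← Finset.prod_inv_distrib, ← Finset.prod_mul_distrib]
    simp only [inv_div, gammaQuotient]
  have hratio : 0 < ∏ k ∈ Finset.Ioi i, Gamma ((l i - l k : ℕ) + hookShift α e i k) /
      Gamma ((l i - l k : ℕ) + (hookShift α e i k + α⁻¹)) :=
    Finset.prod_pos fun k hk => by
      have hshift := hookShift_pos hα he (Fin.lt_def.1 (Finset.mem_Ioi.1 hk))
      exact div_pos (Gamma_add_pos hshift _) (Gamma_add_pos (by positivity) _)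
  have hrow := Gamma_add_pos (hookShift_pos hα he i.isLt) (l i)
  rw [hpairs, gammaTerm, hookConst, mul_pow]
  generalize (∏ k ∈ Finset.Ioi i, Gamma ((l i - l k : ℕ) + hookShift α e i k) /
    Gamma ((l i - l k : ℕ) + (hookShift α e i k + α⁻¹))) = ratio at hratio ⊢
  field_simp

lemma exists_hookWeight_eq {d n : ℕ} {α e : ℝ} (hα : 0 < α) (he : 0 < e) (hd : 0 < d)
    (hn : 0 < n) :
    ∃ K, 0 < K ∧ ∀ l ∈ partitions d n, hookWeight α e n l = K / hookProd α e l := by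
  have hconst : 0 < ∏ i : Fin d, hookConst α e n i :=
    Finset.prod_pos fun i _ => hookConst_pos hα he hn i
  refine ⟨(∏ i : Fin d, hookConst α e n i) * (α * (n / d)) ^ n, by positivity, fun l hl => ?_⟩
  obtain ⟨hsum, hanti⟩ := mem_partitions.1 hl
  rw [eq_div_iff (hookProd_pos hα.le he hanti).ne', hookWeight_mul_hookProd hα he n hanti,
    Finset.prod_mul_distrib, Finset.prod_pow_eq_pow_sum, hsum]

lemma tendsto_hookWeight {d : ℕ} {α e : ℝ} (hα : 0 < α) (he : 0 < e) {l : ℕ → Fin d → ℕ}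
    {x : Fin d → ℝ} (hl : ∀ᶠ n in atTop, Antitone (l n)) (hx : StrictAnti x)
    (hlx : ∀ i, Tendsto (fun n => rescale d α n (l n) i) atTop (𝓝 (x i))) :
    Tendsto (fun n => hookWeight α e n (l n)) atTop (𝓝 (TracelessGBE.weight α⁻¹ x)) := by
  have hexp : exp (-(α⁻¹ / 2) * ∑ i, x i ^ 2) = ∏ i, exp (-((x i / √α) ^ 2 / 2)) := by
    rw [Finset.mul_sum, exp_sum]
    refine Finset.prod_congr rfl fun i _ => ?_
    rw [div_pow, sq_sqrt hα.le]
    ring_nf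
  rw [TracelessGBE.weight_eq_prod_Ioi, hexp, ← Finset.prod_mul_distrib]
  refine tendsto_finsetProd _ fun i _ => Tendsto.mul ?_ (tendsto_finsetProd _ fun k hk => ?_)
  · have hd : (0 : ℝ) < d := by exact_mod_cast i.pos
    refine tendsto_gammaTerm (hookShift_pos hα he i.isLt)
      (tendsto_natCast_atTop_atTop.atTop_div_const hd) ?_
    simp only [sub_div_sqrt_eq_rescale_div hα]
    exact (hlx i).div_const _
  · have hik := Finset.mem_Ioi.1 hk
    have hshift := hookShift_pos hα he (Fin.lt_def.1 hik)
    refine tendsto_gammaQuotient hshift (by positivity) (mesh_nonneg d α) (tendsto_mesh d α) ?_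
      (sub_pos.2 (hx hik))
    refine ((hlx i).sub (hlx k)).congr' ?_
    filter_upwards [hl] with n hn
    exact (mesh_mul_sub hn hik.le).symm

lemma exists_gammaTerm_row_le {d : ℕ} {α e : ℝ} (hα : 0 < α) (he : 0 < e) (M : ℝ) (i : Fin d) :
    ∃ C, 0 < C ∧ ∀ n : ℕ, 0 < n → ∀ l ∈ partitions d n,
      gammaTerm (hookShift α e i d) (n / d) (l i) ≤ C * exp (-(M * |rescale d α n l i|)) := by
  have hd : (1 : ℝ) ≤ d := by exact_mod_cast i.pos
  obtain ⟨C, hC, hle⟩ := exists_gammaTerm_le (hookShift_pos hα he i.isLt) hd (√α * M)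
  refine ⟨C, hC, fun n hn l hl => ?_⟩
  have hdn : (d : ℝ) * (n / d) = n := by field_simp
  have hli : l i ≤ n := by
    rw [← (mem_partitions.1 hl).1]
    exact Finset.single_le_sum (fun j _ => Nat.zero_le (l j)) (Finset.mem_univ i)
  have hbound := hle (n / d) (l i) (by rw [hdn]; exact_mod_cast hn)
    (by rw [hdn]; exact_mod_cast hli)
  have hsqrt : 0 < √α := sqrt_pos.2 hα
  rwa [sub_div_sqrt_eq_rescale_div hα, abs_div, abs_of_pos hsqrt, mul_right_comm,
    mul_div_cancel₀ _ hsqrt.ne', mul_comm _ M] at hbound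

lemma exists_prod_gammaQuotient_le {d : ℕ} {α e : ℝ} (hα : 0 < α) (he : 0 < e) :
    ∃ C, 0 < C ∧ ∀ n, 0 < n → ∀ l : Fin d → ℕ, Antitone l →
      ∏ i : Fin d, ∏ k ∈ Finset.Ioi i,
          gammaQuotient (hookShift α e i k) α⁻¹ (mesh d α n) (l i - l k) ≤
        C * exp (α⁻¹ * (2 * d * ∑ i, |rescale d α n l i|)) := by
  have hpair : ∀ i k : Fin d, ∃ C, 0 < C ∧ (i < k → ∀ (s : ℝ) (m : ℕ), 0 ≤ s → s ≤ √(α * d) →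
      gammaQuotient (hookShift α e i k) α⁻¹ s m ≤ C * exp (α⁻¹ * (s * m))) := by
    intro i k
    by_cases hik : i < k
    · obtain ⟨C, hC, hle⟩ := exists_gammaQuotient_le (hookShift_pos hα he (Fin.lt_def.1 hik))
        (inv_nonneg.2 hα.le) (√(α * d))
      exact ⟨C, hC, fun _ => hle⟩
    · exact ⟨1, one_pos, fun h => absurd h hik⟩
  choose C hC hle using hpair
  have hC_pos : 0 < ∏ i, ∏ k ∈ Finset.Ioi i, C i k :=
    Finset.prod_pos fun i _ => Finset.prod_pos fun k _ => hC i k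
  refine ⟨_, hC_pos, fun n hn l hl => ?_⟩
  calc ∏ i : Fin d, ∏ k ∈ Finset.Ioi i,
        gammaQuotient (hookShift α e i k) α⁻¹ (mesh d α n) (l i - l k)
      ≤ ∏ i, ∏ k ∈ Finset.Ioi i,
          C i k * exp (α⁻¹ * (rescale d α n l i - rescale d α n l k)) := by
        refine Finset.prod_le_prod (fun i _ => prod_gammaQuotient_nonneg hα he n l i) fun i _ =>
          Finset.prod_le_prod (fun k hk => ?_) fun k hk => ?_
        · have hshift := hookShift_pos hα he (Fin.lt_def.1 (Finset.mem_Ioi.1 hk))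
          exact gammaQuotient_nonneg hshift (by positivity) (mesh_nonneg d α n) _
        · rw [← mesh_mul_sub hl (Finset.mem_Ioi.1 hk).le]
          exact hle i k (Finset.mem_Ioi.1 hk) _ _ (mesh_nonneg d α n) (mesh_le hα.le hn)
    _ = (∏ i, ∏ k ∈ Finset.Ioi i, C i k) * exp (α⁻¹ *
          ∑ i, ∑ k ∈ Finset.Ioi i, (rescale d α n l i - rescale d α n l k)) := by
        simp only [Finset.prod_mul_distrib, Finset.mul_sum, exp_sum]
    _ ≤ _ := by
        gcongr
        exact TracelessGBE.sum_sum_Ioi_sub_le _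

lemma exists_hookWeight_le {α e : ℝ} (hα : 0 < α) (he : 0 < e) (d : ℕ) (M : ℝ) :
    ∃ C, 0 < C ∧ ∀ n : ℕ, 0 < n → ∀ l ∈ partitions d n,
      hookWeight α e n l ≤ C * exp (-(M * ∑ i, |rescale d α n l i|)) := by
  choose A hA hrow using
    fun i : Fin d => exists_gammaTerm_row_le hα he (M + α⁻¹ * (2 * d)) i
  obtain ⟨B, hB, hpairs⟩ := exists_prod_gammaQuotient_le (d := d) hα he
  have hA_pos : 0 < ∏ i, A i := Finset.prod_pos fun i _ => hA i
  refine ⟨(∏ i, A i) * B, by positivity, fun n hn l hl => ?_⟩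
  have hrows : ∏ i : Fin d, gammaTerm (hookShift α e i d) (n / d) (l i) ≤
      (∏ i, A i) * exp (-((M + α⁻¹ * (2 * d)) * ∑ i, |rescale d α n l i|)) := by
    rw [Finset.mul_sum, ← Finset.sum_neg_distrib, exp_sum, ← Finset.prod_mul_distrib]
    refine Finset.prod_le_prod (fun i _ => ?_) fun i _ => hrow i n hn l hl
    have hd : (0 : ℝ) < d := by exact_mod_cast i.pos
    exact (gammaTerm_pos (hookShift_pos hα he i.isLt) (by positivity) _).le
  rw [hookWeight, Finset.prod_mul_distrib]
  have hprod_nonneg := Finset.prod_nonneg fun i (_ : i ∈ Finset.univ) =>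
    prod_gammaQuotient_nonneg hα he n l i
  refine (mul_le_mul hrows (hpairs n hn l (mem_partitions.1 hl).2) hprod_nonneg
    (by positivity)).trans_eq ?_
  rw [mul_mul_mul_comm, ← exp_add]
  ring_nf

/-- The weight `1 / (hookLower α l * hookUpper α l)` of the Jack measure, up to a factor depending
only on `n` that makes it converge to the weight of the Gaussian ensemble. -/
def jackWeight {d : ℕ} (α : ℝ) (n : ℕ) (l : Fin d → ℕ) : ℝ :=
  hookWeight α 1 n l * hookWeight α α n l

lemma exists_jackWeight_eq {d n : ℕ} {α : ℝ} (hα : 0 < α) (hd : 0 < d) (hn : 0 < n) :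
    ∃ K, 0 < K ∧ ∀ l ∈ partitions d n,
      jackWeight α n l = K * (1 / (hookLower α l * hookUpper α l)) := by
  obtain ⟨K₁, hK₁, hlower⟩ := exists_hookWeight_eq hα one_pos hd hn
  obtain ⟨K₂, hK₂, hupper⟩ := exists_hookWeight_eq hα hα hd hn
  refine ⟨K₁ * K₂, mul_pos hK₁ hK₂, fun l hl => ?_⟩
  rw [jackWeight, hlower l hl, hupper l hl, hookLower_eq, hookUpper_eq, div_mul_div_comm,
    mul_one_div]

lemma jackWeight_nonneg {d n : ℕ} {α : ℝ} (hα : 0 < α) (hn : 0 < n) (l : Fin d → ℕ) :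
    0 ≤ jackWeight α n l :=
  mul_nonneg (hookWeight_nonneg hα one_pos hn l) (hookWeight_nonneg hα hα hn l)

lemma tendsto_jackWeight {d : ℕ} {α : ℝ} (hα : 0 < α) {l : ℕ → Fin d → ℕ} {x : Fin d → ℝ}
    (hl : ∀ᶠ n in atTop, Antitone (l n)) (hx : StrictAnti x)
    (hlx : Tendsto (fun n => rescale d α n (l n)) atTop (𝓝 x)) :
    Tendsto (fun n => jackWeight α n (l n)) atTop (𝓝 (TracelessGBE.weight (2 / α) x)) := by
  rw [div_eq_mul_inv, two_mul, TracelessGBE.weight_add _ _ hx]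
  have hlx_apply := tendsto_pi_nhds.1 hlx
  exact (tendsto_hookWeight hα one_pos hl hx hlx_apply).mul
    (tendsto_hookWeight hα hα hl hx hlx_apply)

lemma exists_jackWeight_le {α : ℝ} (hα : 0 < α) (d : ℕ) :
    ∃ C, 0 < C ∧ ∀ n : ℕ, 0 < n → ∀ l ∈ partitions d n,
      jackWeight α n l ≤ C * exp (-∑ i, |rescale d α n l i|) := by
  obtain ⟨C₁, hC₁, hlower⟩ := exists_hookWeight_le hα one_pos d (1 / 2)
  obtain ⟨C₂, hC₂, hupper⟩ := exists_hookWeight_le hα hα d (1 / 2)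
  refine ⟨C₁ * C₂, mul_pos hC₁ hC₂, fun n hn l hl => ?_⟩
  refine (mul_le_mul (hlower n hn l hl) (hupper n hn l hl) (hookWeight_nonneg hα hα hn l)
    (by positivity)).trans_eq ?_
  rw [mul_mul_mul_comm, ← exp_add]
  ring_nf

end JackMeasure

namespace TracelessGBE

/-! ### The hyperplane of traceless vectors in its first `d - 1` coordinates -/

section Geometry

variable {m : ℕ}

lemma lift_castSucc (y : Fin m → ℝ) (i : Fin m) : lift (m + 1) y i.castSucc = y i := by
  simp [lift]

lemma lift_last (y : Fin m → ℝ) : lift (m + 1) y (Fin.last m) = -∑ k, y k := by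
  simp [lift]

lemma lift_castSucc_comp {x : Fin (m + 1) → ℝ} (hx : ∑ i, x i = 0) :
    lift (m + 1) (fun i => x i.castSucc) = x := by
  rw [Fin.sum_univ_castSucc] at hx
  funext i
  induction i using Fin.lastCases with
  | last => rw [lift_last, ← eq_neg_of_add_eq_zero_right hx]
  | cast i => rw [lift_castSucc]

/-- `lift` as a linear map. -/
def liftLinearMap (m : ℕ) : (Fin m → ℝ) →ₗ[ℝ] Fin (m + 1) → ℝ where
  toFun := lift (m + 1)
  map_add' y z := by
    funext i
    induction i using Fin.lastCases with
    | last => simp [lift_last, Finset.sum_add_distrib, add_comm]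
    | cast i => simp [lift_castSucc]
  map_smul' c y := by
    funext i
    induction i using Fin.lastCases with
    | last => simp [lift_last, Finset.mul_sum]
    | cast i => simp [lift_castSucc]

lemma continuous_lift (m : ℕ) : Continuous (lift (m + 1)) :=
  (liftLinearMap m).continuous_of_finiteDimensional

lemma abs_lift_le {w : Fin m → ℝ} {s : ℝ} (hs : 0 ≤ s) (hw : ∀ i, |w i| ≤ s) (i : Fin (m + 1)) :
    |lift (m + 1) w i| ≤ (m + 1) * s := by
  induction i using Fin.lastCases with
  | last =>
    rw [lift_last, abs_neg]
    calc |∑ k, w k| ≤ ∑ k, |w k| := Finset.abs_sum_le_sum_abs _ _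
      _ ≤ ∑ _k : Fin m, s := Finset.sum_le_sum fun k _ => hw k
      _ = m * s := by simp
      _ ≤ (m + 1) * s := by gcongr; linarith
  | cast i =>
    rw [lift_castSucc]
    exact (hw i).trans (le_mul_of_one_le_left hs (by simp))

lemma mem_chamber {d : ℕ} {y : Fin (d - 1) → ℝ} : y ∈ chamber d ↔ Antitone (lift d y) := by
  simp [chamber, Antitone]

lemma measurableSet_chamber (m : ℕ) : MeasurableSet (chamber (m + 1)) := by
  have hclosed : IsClosed {x : Fin (m + 1) → ℝ | Antitone x} := isClosed_antitone
  exact (hclosed.preimage (continuous_lift m)).measurableSet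

lemma isOpen_strictAnti_lift (m : ℕ) : IsOpen {y : Fin m → ℝ | StrictAnti (lift (m + 1) y)} := by
  simp only [StrictAnti, Set.ofPred_forall]
  exact isOpen_iInter_of_finite fun i => isOpen_iInter_of_finite fun j =>
    isOpen_iInter_of_finite fun _ =>
      isOpen_lt ((continuous_apply j).comp (continuous_lift m))
        ((continuous_apply i).comp (continuous_lift m))

lemma exists_strictAnti_lift (m : ℕ) : ∃ y : Fin m → ℝ, StrictAnti (lift (m + 1) y) := by
  set mean : ℝ := (∑ i : Fin (m + 1), ((i : ℕ) : ℝ)) / (m + 1 : ℕ) with hmean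
  let x : Fin (m + 1) → ℝ := fun i => mean - (i : ℕ)
  have hsum : ∑ i, x i = 0 := by
    rw [Finset.sum_sub_distrib, Finset.sum_const, Finset.card_univ, Fintype.card_fin, nsmul_eq_mul,
      hmean, mul_div_cancel₀ _ (Nat.cast_ne_zero.2 m.succ_ne_zero), sub_self]
  have hanti : StrictAnti x := fun i j hij => sub_lt_sub_left (Nat.cast_lt.2 hij) mean
  exact ⟨fun i => x i.castSucc, (lift_castSucc_comp hsum).symm ▸ hanti⟩

lemma ae_lift_ne {i j : Fin (m + 1)} (hij : i ≠ j) :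
    ∀ᵐ y : Fin m → ℝ, lift (m + 1) y i ≠ lift (m + 1) y j := by
  let difference : (Fin m → ℝ) →ₗ[ℝ] ℝ :=
    (LinearMap.proj (R := ℝ) (φ := fun _ : Fin (m + 1) => ℝ) i - LinearMap.proj j) ∘ₗ
      liftLinearMap m
  have hdifference : ∀ y, difference y = lift (m + 1) y i - lift (m + 1) y j := fun _ => rfl
  have hker : LinearMap.ker difference ≠ ⊤ := fun htop => by
    obtain ⟨y, hy⟩ := exists_strictAnti_lift m
    have hmem : y ∈ LinearMap.ker difference := htop ▸ Submodule.mem_top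
    rw [LinearMap.mem_ker, hdifference, sub_eq_zero] at hmem
    exact hij (hy.injective hmem)
  have hnull := Measure.addHaar_submodule (volume : Measure (Fin m → ℝ)) _ hker
  filter_upwards [measure_eq_zero_iff_ae_notMem.1 hnull] with y hy heq
  exact hy (by rw [SetLike.mem_coe, LinearMap.mem_ker, hdifference, heq, sub_self])

lemma ae_strictAnti_or_notMem_chamber (m : ℕ) :
    ∀ᵐ y : Fin m → ℝ, StrictAnti (lift (m + 1) y) ∨ y ∉ chamber (m + 1) := by
  have hne : ∀ᵐ y : Fin m → ℝ, ∀ i j : Fin (m + 1), i ≠ j →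
      lift (m + 1) y i ≠ lift (m + 1) y j := by
    simp only [ae_all_iff]
    exact fun i j hij => ae_lift_ne hij
  filter_upwards [hne] with y hy
  rw [or_iff_not_imp_right, not_not, mem_chamber]
  exact fun hanti => hanti.strictAnti_of_injective fun i j h => by_contra fun hij => hy i j hij h

end Geometry

/-! ### The law of the traceless ensemble -/

lemma measurable_weight_lift (m : ℕ) (β : ℝ) :
    Measurable fun y : Fin m → ℝ => weight β (lift (m + 1) y) := by
  have hweight : Measurable fun x : Fin (m + 1) → ℝ => weight β x := by
    unfold weight
    fun_prop
  exact hweight.comp (continuous_lift m).measurable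

lemma integrable_exp_neg_sum_abs (ι : Type*) [Fintype ι] :
    Integrable fun y : ι → ℝ => exp (-∑ i, |y i|) := by
  have hexp : Integrable fun t : ℝ => exp (-|t|) := by
    rw [← integrableOn_univ, ← Set.Iic_union_Ioi (a := (0 : ℝ))]
    refine IntegrableOn.union ?_ ?_
    · refine (integrableOn_exp_Iic 0).congr_fun (fun t ht => ?_) measurableSet_Iic
      rw [abs_of_nonpos (Set.mem_Iic.1 ht), neg_neg]
    · refine (exp_neg_integrableOn_Ioi 0 one_pos).congr_fun (fun t ht => ?_) measurableSet_Ioi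
      simp only [abs_of_pos (Set.mem_Ioi.1 ht), neg_mul, one_mul]
  have hprod := Integrable.fintype_prod (f := fun (_ : ι) t => exp (-|t|)) fun _ => hexp
  simp only [← Finset.sum_neg_distrib, exp_sum]
  exact hprod

section Law

variable {β : ℝ} (hβ : 0 < β) (m : ℕ)
include hβ

lemma integrableOn_weight :
    IntegrableOn (fun y : Fin m → ℝ => weight β (lift (m + 1) y)) (chamber (m + 1)) := by
  obtain ⟨C, hC, hle⟩ := exists_weight_le hβ (m + 1)
  refine ((integrable_exp_neg_sum_abs (Fin m)).const_mul C).integrableOn.mono'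
    (measurable_weight_lift m β).aestronglyMeasurable ?_
  filter_upwards [ae_restrict_mem (measurableSet_chamber m)] with y hy
  have hanti := mem_chamber.1 hy
  rw [norm_of_nonneg (weight_nonneg β hanti)]
  refine (hle _ hanti).trans ?_
  gcongr
  simp only [Fin.sum_univ_castSucc, lift_castSucc]
  exact le_add_of_nonneg_right (abs_nonneg _)

lemma integral_weight_pos : 0 < ∫ y in chamber (m + 1), weight β (lift (m + 1) y) := by
  have hnonneg : 0 ≤ᵐ[volume.restrict (chamber (m + 1))]
      fun y : Fin m → ℝ => weight β (lift (m + 1) y) := by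
    filter_upwards [ae_restrict_mem (measurableSet_chamber m)] with y hy
    exact weight_nonneg β (mem_chamber.1 hy)
  rw [setIntegral_pos_iff_support_of_nonneg_ae hnonneg (integrableOn_weight hβ m)]
  exact ((isOpen_strictAnti_lift m).measure_pos volume (exists_strictAnti_lift m)).trans_le
    (measure_mono fun y hy => ⟨(weight_pos β hy).ne', mem_chamber.2 (StrictAnti.antitone hy)⟩)

lemma partitionFunction_eq :
    partitionFunction (m + 1) β =
      ENNReal.ofReal (∫ y in chamber (m + 1), weight β (lift (m + 1) y)) := by
  refine (ofReal_integral_eq_lintegral_ofReal (integrableOn_weight hβ m) ?_).symm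
  filter_upwards [ae_restrict_mem (measurableSet_chamber m)] with y hy
  exact weight_nonneg β (mem_chamber.1 hy)

lemma partitionFunction_ne_zero : partitionFunction (m + 1) β ≠ 0 := by
  rw [partitionFunction_eq hβ m]
  exact (ENNReal.ofReal_pos.2 (integral_weight_pos hβ m)).ne'

lemma isProbabilityMeasure_law : IsProbabilityMeasure (law (m + 1) β) := by
  have hZ_top : partitionFunction (m + 1) β ≠ ⊤ := by simp [partitionFunction_eq hβ m]
  constructor
  rw [law, Measure.map_apply (continuous_lift m).measurable MeasurableSet.univ, Set.preimage_univ,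
    withDensity_apply _ MeasurableSet.univ, Measure.restrict_univ, lintegral_const_mul]
  · exact ENNReal.inv_mul_cancel (partitionFunction_ne_zero hβ m) hZ_top
  · exact (measurable_weight_lift m β).ennreal_ofReal

lemma integral_law {f : (Fin (m + 1) → ℝ) → ℝ} (hf : Measurable f) :
    ∫ x, f x ∂law (m + 1) β =
      (∫ y in chamber (m + 1), f (lift (m + 1) y) * weight β (lift (m + 1) y)) /
        ∫ y in chamber (m + 1), weight β (lift (m + 1) y) := by
  rw [law, integral_map (continuous_lift m).measurable.aemeasurable hf.aestronglyMeasurable,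
    integral_withDensity_eq_integral_toReal_smul, ← integral_div]
  · refine setIntegral_congr_fun (measurableSet_chamber m) fun y hy => ?_
    rw [ENNReal.toReal_mul, ENNReal.toReal_ofReal (weight_nonneg β (mem_chamber.1 hy)),
      ENNReal.toReal_inv, partitionFunction_eq hβ m,
      ENNReal.toReal_ofReal (integral_weight_pos hβ m).le, smul_eq_mul]
    ring
  · exact (measurable_weight_lift m β).ennreal_ofReal.const_mul _
  · exact ae_of_all _ fun y => ENNReal.mul_lt_top
      (ENNReal.inv_lt_top.2 (partitionFunction_ne_zero hβ m).bot_lt) ENNReal.ofReal_lt_top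

end Law

end TracelessGBE

namespace JackMeasure

open TracelessGBE

/-! ### Sums over partitions as Riemann sums -/

section RiemannSum

variable {m n : ℕ} {α : ℝ}

lemma sum_rescale {l : Fin (m + 1) → ℕ} (hl : ∑ i, l i = n) :
    ∑ i, rescale (m + 1) α n l i = 0 := by
  have hsum : ∑ i, (l i : ℝ) = n := by exact_mod_cast hl
  simp only [rescale]
  rw [← Finset.mul_sum, Finset.sum_sub_distrib, hsum, Finset.sum_const, Finset.card_univ,
    Fintype.card_fin, nsmul_eq_mul, mul_div_cancel₀ _ (Nat.cast_ne_zero.2 m.succ_ne_zero),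
    sub_self, mul_zero]

/-- The half-open cube of side `mesh (m + 1) α n` whose lowest vertex is formed by the first `m`
coordinates of `rescale (m + 1) α n l`. -/
def cell (α : ℝ) (n : ℕ) (l : Fin (m + 1) → ℕ) : Set (Fin m → ℝ) :=
  Set.pi Set.univ fun i => Set.Ico (rescale (m + 1) α n l i.castSucc)
    (rescale (m + 1) α n l i.castSucc + mesh (m + 1) α n)

lemma measurableSet_cell (α : ℝ) (n : ℕ) (l : Fin (m + 1) → ℕ) : MeasurableSet (cell α n l) :=
  MeasurableSet.univ_pi fun _ => measurableSet_Ico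

lemma volume_cell (α : ℝ) (n : ℕ) (l : Fin (m + 1) → ℕ) :
    volume (cell α n l) = ENNReal.ofReal (mesh (m + 1) α n) ^ m := by
  simp [cell, Real.volume_pi_Ico]

lemma abs_rescale_castSucc_sub_le {l : Fin (m + 1) → ℕ} {y : Fin m → ℝ} (hy : y ∈ cell α n l)
    (i : Fin m) : |rescale (m + 1) α n l i.castSucc - y i| ≤ mesh (m + 1) α n := by
  obtain ⟨hle, hlt⟩ := hy i (Set.mem_univ i)
  rw [abs_le]
  constructor <;> linarith

lemma abs_rescale_sub_lift_le {l : Fin (m + 1) → ℕ} (hl : ∑ i, l i = n) {y : Fin m → ℝ}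
    (hy : y ∈ cell α n l) (i : Fin (m + 1)) :
    |rescale (m + 1) α n l i - lift (m + 1) y i| ≤ (m + 1) * mesh (m + 1) α n := by
  have hsub : rescale (m + 1) α n l - lift (m + 1) y =
      lift (m + 1) ((fun i => rescale (m + 1) α n l i.castSucc) - y) := by
    conv_lhs => rw [← lift_castSucc_comp (sum_rescale hl)]
    exact ((liftLinearMap m).map_sub _ y).symm
  rw [← Pi.sub_apply, hsub]
  exact abs_lift_le (mesh_nonneg _ _ _) (abs_rescale_castSucc_sub_le hy) i

lemma mem_cell_iff (hmesh : 0 < mesh (m + 1) α n) {l : Fin (m + 1) → ℕ} {y : Fin m → ℝ} :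
    y ∈ cell α n l ↔ ∀ i : Fin m,
      (l i.castSucc : ℝ) ≤ y i / mesh (m + 1) α n + n / (m + 1 : ℕ) ∧
        y i / mesh (m + 1) α n + n / (m + 1 : ℕ) < l i.castSucc + 1 := by
  simp only [cell, Set.mem_univ_pi, Set.mem_Ico]
  refine forall_congr' fun i => ?_
  have hrescale : rescale (m + 1) α n l i.castSucc =
      (l i.castSucc - n / (m + 1 : ℕ)) * mesh (m + 1) α n := mul_comm _ _
  rw [hrescale, ← add_one_mul, ← le_div_iff₀ hmesh, ← div_lt_iff₀ hmesh, sub_le_iff_le_add,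
    sub_add_eq_add_sub, lt_sub_iff_add_lt]

/-- The composition of `n` whose cell contains `y`. It is meaningful only for large `n`: the floor
of a negative number and the difference in the last coordinate are truncated to zero. -/
def latticePoint (α : ℝ) (n : ℕ) (y : Fin m → ℝ) : Fin (m + 1) → ℕ :=
  Fin.snoc (α := fun _ => ℕ) (fun i => ⌊y i / mesh (m + 1) α n + n / (m + 1 : ℕ)⌋₊)
    (n - ∑ i : Fin m, ⌊y i / mesh (m + 1) α n + n / (m + 1 : ℕ)⌋₊)

lemma latticePoint_castSucc (y : Fin m → ℝ) (i : Fin m) :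
    latticePoint α n y i.castSucc = ⌊y i / mesh (m + 1) α n + n / (m + 1 : ℕ)⌋₊ := by
  simp [latticePoint]

lemma latticePoint_last (y : Fin m → ℝ) :
    latticePoint α n y (Fin.last m) = n - ∑ i : Fin m, latticePoint α n y i.castSucc := by
  simp [latticePoint]

lemma eq_latticePoint_of_mem_cell (hmesh : 0 < mesh (m + 1) α n) {l : Fin (m + 1) → ℕ}
    (hl : ∑ i, l i = n) {y : Fin m → ℝ} (hy : y ∈ cell α n l) : l = latticePoint α n y := by
  have hfloor : ∀ i : Fin m, l i.castSucc = latticePoint α n y i.castSucc := fun i => by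
    rw [latticePoint_castSucc, Nat.floor_eq_on_Ico (l i.castSucc) _ ((mem_cell_iff hmesh).1 hy i)]
  funext i
  induction i using Fin.lastCases with
  | last =>
    rw [Fin.sum_univ_castSucc, Finset.sum_congr rfl fun i _ => hfloor i] at hl
    rw [latticePoint_last]
    exact Nat.eq_sub_of_add_eq' hl
  | cast i => exact hfloor i

section LatticePoint

variable {y : Fin m → ℝ}
  (hy : ∀ i, 0 ≤ lift (m + 1) y i / mesh (m + 1) α n + (n : ℝ) / (m + 1 : ℕ))
include hy

lemma mem_cell_latticePoint (hmesh : 0 < mesh (m + 1) α n) :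
    y ∈ cell α n (latticePoint α n y) := by
  refine (mem_cell_iff hmesh).2 fun i => ?_
  have hyi := hy i.castSucc
  rw [lift_castSucc] at hyi
  rw [latticePoint_castSucc]
  exact ⟨Nat.floor_le hyi, Nat.lt_floor_add_one _⟩

lemma sum_latticePoint : ∑ i, latticePoint α n y i = n := by
  have hle : ∑ i : Fin m, latticePoint α n y i.castSucc ≤ n := by
    have hlast := hy (Fin.last m)
    rw [lift_last, neg_div, Finset.sum_div] at hlast
    rw [← Nat.cast_le (α := ℝ), Nat.cast_sum]
    calc ∑ i : Fin m, (latticePoint α n y i.castSucc : ℝ)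
        ≤ ∑ i : Fin m, (y i / mesh (m + 1) α n + n / (m + 1 : ℕ)) := by
          refine Finset.sum_le_sum fun i _ => ?_
          have hyi := hy i.castSucc
          rw [lift_castSucc] at hyi
          rw [latticePoint_castSucc]
          exact Nat.floor_le hyi
      _ = ∑ i : Fin m, y i / mesh (m + 1) α n + m * (n / (m + 1 : ℕ)) := by
          simp [Finset.sum_add_distrib]
      _ ≤ n / (m + 1 : ℕ) + m * (n / (m + 1 : ℕ)) := by linarith
      _ = n := by push_cast; field_simp; ring
  rw [Fin.sum_univ_castSucc, latticePoint_last, Nat.add_sub_cancel' hle]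

end LatticePoint

lemma tendsto_mesh_mul_mean {d : ℕ} (hα : 0 < α) (hd : 0 < d) :
    Tendsto (fun n : ℕ => mesh d α n * ((n : ℝ) / d)) atTop atTop := by
  have hmean : Tendsto (fun n : ℕ => (n : ℝ) / d) atTop atTop :=
    tendsto_natCast_atTop_atTop.atTop_div_const (Nat.cast_pos.2 hd)
  refine ((tendsto_sqrt_atTop.comp hmean).const_mul_atTop (sqrt_pos.2 hα)).congr fun n => ?_
  rw [mesh_eq hα.le, div_mul_eq_mul_div, mul_div_assoc, div_sqrt, Function.comp_apply]

lemma eventually_nonneg_div_mesh_add {d : ℕ} (hα : 0 < α) (hd : 0 < d) (t : ℝ) :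
    ∀ᶠ n : ℕ in atTop, 0 ≤ t / mesh d α n + (n : ℝ) / d := by
  filter_upwards [(tendsto_mesh_mul_mean hα hd).eventually_ge_atTop (-t), eventually_gt_atTop 0]
    with n hn hn0
  have hmesh := mesh_pos hα hd hn0
  rw [← mul_div_cancel_left₀ ((n : ℝ) / d) hmesh.ne', ← add_div]
  exact div_nonneg (neg_le_iff_add_nonneg'.1 hn) hmesh.le

lemma eventually_mem_cell_latticePoint (hα : 0 < α) (y : Fin m → ℝ) :
    ∀ᶠ n in atTop, ∑ i, latticePoint α n y i = n ∧ y ∈ cell α n (latticePoint α n y) := by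
  have hnonneg : ∀ᶠ n : ℕ in atTop, ∀ i,
      0 ≤ lift (m + 1) y i / mesh (m + 1) α n + (n : ℝ) / (m + 1 : ℕ) :=
    eventually_all.2 fun i => eventually_nonneg_div_mesh_add hα m.succ_pos _
  filter_upwards [hnonneg, eventually_gt_atTop 0] with n hn hn0
  exact ⟨sum_latticePoint hn, mem_cell_latticePoint hn (mesh_pos hα m.succ_pos hn0)⟩

lemma tendsto_rescale_latticePoint (hα : 0 < α) (y : Fin m → ℝ) :
    Tendsto (fun n => rescale (m + 1) α n (latticePoint α n y)) atTop (𝓝 (lift (m + 1) y)) := by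
  refine tendsto_pi_nhds.2 fun i => tendsto_iff_norm_sub_tendsto_zero.2 ?_
  have herror := (tendsto_mesh (m + 1) α).const_mul ((m : ℝ) + 1)
  rw [mul_zero] at herror
  refine squeeze_zero' (Eventually.of_forall fun _ => norm_nonneg _) ?_ herror
  filter_upwards [eventually_mem_cell_latticePoint hα y] with n hn
  exact abs_rescale_sub_lift_le hn.1 hn.2 i

lemma eventually_latticePoint_mem_partitions (hα : 0 < α) {y : Fin m → ℝ}
    (hy : StrictAnti (lift (m + 1) y)) :
    ∀ᶠ n in atTop, latticePoint α n y ∈ partitions (m + 1) n := by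
  have hrescale := tendsto_pi_nhds.1 (tendsto_rescale_latticePoint hα y)
  have hanti : ∀ᶠ n in atTop, ∀ i j, i < j →
      rescale (m + 1) α n (latticePoint α n y) j < rescale (m + 1) α n (latticePoint α n y) i := by
    simp only [eventually_all]
    exact fun i j hij => (hrescale j).eventually_lt (hrescale i) (hy hij)
  filter_upwards [hanti, eventually_mem_cell_latticePoint hα y] with n hn hcell
  refine mem_partitions.2 ⟨hcell.1, StrictAnti.antitone fun i j hij => ?_⟩
  have hlt := lt_of_mul_lt_mul_left (hn i j hij) (mesh_nonneg _ _ _)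
  exact_mod_cast (sub_lt_sub_iff_right _).1 hlt

lemma eventually_notMem_cell {y : Fin m → ℝ} (hα : 0 < α) (hy : y ∉ chamber (m + 1)) :
    ∀ᶠ n in atTop, ∀ l ∈ partitions (m + 1) n, y ∉ cell α n l := by
  rw [mem_chamber] at hy
  simp only [Antitone, not_forall, not_le] at hy
  obtain ⟨i, j, hij, hlt⟩ := hy
  have hrescale := tendsto_pi_nhds.1 (tendsto_rescale_latticePoint hα y)
  filter_upwards [(hrescale i).eventually_lt (hrescale j) hlt, eventually_gt_atTop 0]
    with n hn hn0 l hl hyl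
  obtain ⟨hsum, hanti⟩ := mem_partitions.1 hl
  rw [← eq_latticePoint_of_mem_cell (mesh_pos hα m.succ_pos hn0) hsum hyl] at hn
  exact hn.not_ge (antitone_rescale α n hanti hij)

/-- The function equal to `F l` on the cell of each partition `l` of `n` with at most `m + 1`
parts, and to `0` off these cells. -/
def stepFun (α : ℝ) (n : ℕ) (F : (Fin (m + 1) → ℕ) → ℝ) (y : Fin m → ℝ) : ℝ :=
  ∑ l ∈ partitions (m + 1) n, (cell α n l).indicator (fun _ => F l) y

lemma stepFun_eq_of_mem (hmesh : 0 < mesh (m + 1) α n) (F : (Fin (m + 1) → ℕ) → ℝ)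
    {l : Fin (m + 1) → ℕ} (hl : l ∈ partitions (m + 1) n) {y : Fin m → ℝ} (hy : y ∈ cell α n l) :
    stepFun α n F y = F l := by
  rw [stepFun, Finset.sum_eq_single_of_mem l hl, Set.indicator_of_mem hy]
  refine fun l' hl' hne => Set.indicator_of_notMem (fun hy' => hne ?_) _
  rw [eq_latticePoint_of_mem_cell hmesh (mem_partitions.1 hl).1 hy,
    eq_latticePoint_of_mem_cell hmesh (mem_partitions.1 hl').1 hy']

lemma stepFun_eq_zero {F : (Fin (m + 1) → ℕ) → ℝ} {y : Fin m → ℝ}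
    (hy : ∀ l ∈ partitions (m + 1) n, y ∉ cell α n l) : stepFun α n F y = 0 :=
  Finset.sum_eq_zero fun l hl => Set.indicator_of_notMem (hy l hl) _

lemma measurable_stepFun (F : (Fin (m + 1) → ℕ) → ℝ) : Measurable (stepFun α n F) :=
  Finset.measurable_sum _ fun l _ => measurable_const.indicator (measurableSet_cell α n l)

lemma integral_stepFun (F : (Fin (m + 1) → ℕ) → ℝ) :
    ∫ y, stepFun α n F y = mesh (m + 1) α n ^ m * ∑ l ∈ partitions (m + 1) n, F l := by
  unfold stepFun
  rw [integral_finsetSum, Finset.mul_sum]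
  · refine Finset.sum_congr rfl fun l _ => ?_
    rw [integral_indicator_const _ (measurableSet_cell α n l), measureReal_def, volume_cell,
      ENNReal.toReal_pow, ENNReal.toReal_ofReal (mesh_nonneg _ _ _), smul_eq_mul]
  · intro l _
    rw [integrable_indicator_iff (measurableSet_cell α n l)]
    refine integrableOn_const ?_
    rw [volume_cell]
    finiteness

lemma abs_stepFun_le (hα : 0 < α) (hn : 0 < n) {C : ℝ} (hC : 0 ≤ C) {F : (Fin (m + 1) → ℕ) → ℝ}
    (hF : ∀ l ∈ partitions (m + 1) n, |F l| ≤ C * exp (-∑ i, |rescale (m + 1) α n l i|))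
    (y : Fin m → ℝ) :
    |stepFun α n F y| ≤ C * exp (m * √(α * (m + 1 : ℕ))) * exp (-∑ i, |y i|) := by
  by_cases hcell : ∃ l ∈ partitions (m + 1) n, y ∈ cell α n l
  swap
  · push Not at hcell
    rw [stepFun_eq_zero hcell, abs_zero]
    positivity
  obtain ⟨l, hl, hy⟩ := hcell
  rw [stepFun_eq_of_mem (mesh_pos hα m.succ_pos hn) F hl hy, mul_assoc, ← exp_add]
  refine (hF l hl).trans ?_
  gcongr
  have hcoord : ∀ i : Fin m,
      |y i| ≤ |rescale (m + 1) α n l i.castSucc| + √(α * (m + 1 : ℕ)) := fun i => by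
    have hdist := (abs_rescale_castSucc_sub_le hy i).trans (mesh_le hα.le hn)
    rw [abs_sub_comm] at hdist
    linarith [abs_sub_abs_le_abs_sub (y i) (rescale (m + 1) α n l i.castSucc)]
  have hsum := Finset.sum_le_sum fun i (_ : i ∈ Finset.univ) => hcoord i
  rw [Finset.sum_add_distrib, Finset.sum_const, Finset.card_univ, Fintype.card_fin,
    nsmul_eq_mul] at hsum
  rw [Fin.sum_univ_castSucc]
  linarith [abs_nonneg (rescale (m + 1) α n l (Fin.last m))]

section Limit

variable {F : ℕ → (Fin (m + 1) → ℕ) → ℝ} {G : (Fin (m + 1) → ℝ) → ℝ} (hα : 0 < α)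
  (hlim : ∀ (x : Fin (m + 1) → ℝ) (l : ℕ → Fin (m + 1) → ℕ), StrictAnti x →
    (∀ᶠ n in atTop, l n ∈ partitions (m + 1) n) →
    Tendsto (fun n => rescale (m + 1) α n (l n)) atTop (𝓝 x) →
    Tendsto (fun n => F n (l n)) atTop (𝓝 (G x)))
include hα hlim

lemma ae_tendsto_stepFun : ∀ᵐ y : Fin m → ℝ, Tendsto (fun n => stepFun α n (F n) y) atTop
    (𝓝 ((chamber (m + 1)).indicator (fun y => G (lift (m + 1) y)) y)) := by
  filter_upwards [ae_strictAnti_or_notMem_chamber m] with y hy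
  rcases hy with hanti | hmem
  · rw [Set.indicator_of_mem (mem_chamber.2 hanti.antitone)]
    have hpartition := eventually_latticePoint_mem_partitions hα hanti
    refine (hlim _ _ hanti hpartition (tendsto_rescale_latticePoint hα y)).congr' ?_
    filter_upwards [hpartition, eventually_mem_cell_latticePoint hα y, eventually_gt_atTop 0]
      with n hn hcell hn0
    exact (stepFun_eq_of_mem (mesh_pos hα m.succ_pos hn0) _ hn hcell.2).symm
  · rw [Set.indicator_of_notMem hmem]
    refine tendsto_const_nhds.congr' ?_
    filter_upwards [eventually_notMem_cell hα hmem] with n hn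
    exact (stepFun_eq_zero hn).symm

theorem tendsto_mesh_pow_mul_sum_partitions {C : ℝ} (hC : 0 ≤ C)
    (hbound : ∀ n, 0 < n → ∀ l ∈ partitions (m + 1) n,
      |F n l| ≤ C * exp (-∑ i, |rescale (m + 1) α n l i|)) :
    Tendsto (fun n => mesh (m + 1) α n ^ m * ∑ l ∈ partitions (m + 1) n, F n l) atTop
      (𝓝 (∫ y in chamber (m + 1), G (lift (m + 1) y))) := by
  simp only [← integral_indicator (measurableSet_chamber m), ← integral_stepFun]
  refine tendsto_integral_filter_of_dominated_convergence
    (fun y => C * exp (m * √(α * (m + 1 : ℕ))) * exp (-∑ i, |y i|))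
    (Eventually.of_forall fun n => (measurable_stepFun (F n)).aestronglyMeasurable) ?_
    ((integrable_exp_neg_sum_abs (Fin m)).const_mul _) (ae_tendsto_stepFun hα hlim)
  filter_upwards [eventually_gt_atTop 0] with n hn
  exact ae_of_all _ (abs_stepFun_le hα hn hC (hbound n hn))

end Limit

end RiemannSum

/-! ### Convergence of the restricted Jack measures -/

open scoped BoundedContinuousFunction

section Restricted

variable {d n : ℕ} {α : ℝ}

lemma partitions_nonempty (hd : 0 < d) (n : ℕ) : (partitions d n).Nonempty := by
  obtain ⟨m, rfl⟩ := Nat.exists_eq_succ_of_ne_zero hd.ne'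
  refine ⟨Pi.single 0 n, mem_partitions.2 ⟨by simp, fun i j hij => ?_⟩⟩
  rcases eq_or_ne j 0 with rfl | hj
  · rw [Fin.le_zero_iff.1 hij]
  · simp [Pi.single_eq_of_ne hj]

lemma one_div_hooks_pos (hα : 0 < α) {l : Fin d → ℕ} (hl : Antitone l) :
    0 < 1 / (hookLower α l * hookUpper α l) :=
  one_div_pos.2 (mul_pos (hookProd_pos hα.le one_pos hl) (hookProd_pos hα.le hα hl))

lemma normConst_pos (hα : 0 < α) (hd : 0 < d) (n : ℕ) : 0 < normConst d α n :=
  Finset.sum_pos (fun _ hl => one_div_hooks_pos hα (mem_partitions.1 hl).2)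
    (partitions_nonempty hd n)

lemma prob_nonneg (hα : 0 < α) {l : Fin d → ℕ} (hl : l ∈ partitions d n) : 0 ≤ prob d α n l := by
  have hhooks := one_div_hooks_pos hα (mem_partitions.1 hl).2
  refine mul_nonneg (one_div_nonneg.2 (Finset.sum_nonneg fun k hk => ?_)) hhooks.le
  exact (one_div_hooks_pos hα (mem_partitions.1 hk).2).le

lemma isProbabilityMeasure_restricted (hα : 0 < α) (hd : 0 < d) (n : ℕ) :
    IsProbabilityMeasure (restricted d α n) := by
  constructor
  simp only [restricted, Measure.finsetSum_apply, Measure.smul_apply, measure_univ, smul_eq_mul,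
    mul_one]
  rw [← ENNReal.ofReal_sum_of_nonneg fun l hl => prob_nonneg hα hl]
  simp only [prob]
  rw [← Finset.mul_sum, ← normConst, one_div_mul_cancel (normConst_pos hα hd n).ne',
    ENNReal.ofReal_one]

lemma integral_restricted (hα : 0 < α) (g : (Fin d → ℕ) → ℝ) :
    ∫ l, g l ∂restricted d α n = ∑ l ∈ partitions d n, prob d α n l * g l := by
  rw [restricted, integral_finsetSum_measure]
  · refine Finset.sum_congr rfl fun l hl => ?_
    rw [integral_smul_measure, integral_dirac, ENNReal.toReal_ofReal (prob_nonneg hα hl),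
      smul_eq_mul]
  · intro l _
    exact (integrable_dirac (by simp)).smul_measure ENNReal.ofReal_ne_top

lemma integral_restricted_eq_div (hα : 0 < α) (hd : 0 < d) (hn : 0 < n) (g : (Fin d → ℕ) → ℝ) :
    ∫ l, g l ∂restricted d α n =
      (∑ l ∈ partitions d n, g l * jackWeight α n l) / ∑ l ∈ partitions d n, jackWeight α n l := by
  obtain ⟨K, hK, hweight⟩ := exists_jackWeight_eq hα hd hn
  have hnorm : ∑ l ∈ partitions d n, jackWeight α n l = K * normConst d α n := by
    rw [normConst, Finset.mul_sum]
    exact Finset.sum_congr rfl hweight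
  have hnorm_pos := normConst_pos hα hd n
  rw [integral_restricted hα, hnorm, Finset.sum_div]
  refine Finset.sum_congr rfl fun l hl => ?_
  rw [hweight l hl, prob]
  field_simp

end Restricted

section Limit

variable {m : ℕ} {α : ℝ} (hα : 0 < α) (f : (Fin (m + 1) → ℝ) →ᵇ ℝ)
include hα

lemma tendsto_mesh_pow_mul_sum_jackWeight :
    Tendsto (fun n => mesh (m + 1) α n ^ m *
        ∑ l ∈ partitions (m + 1) n, f (rescale (m + 1) α n l) * jackWeight α n l) atTop
      (𝓝 (∫ y in chamber (m + 1), f (lift (m + 1) y) * weight (2 / α) (lift (m + 1) y))) := by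
  obtain ⟨C, hC, hle⟩ := exists_jackWeight_le hα (m + 1)
  refine tendsto_mesh_pow_mul_sum_partitions
    (F := fun n l => f (rescale (m + 1) α n l) * jackWeight α n l)
    (G := fun x => f x * weight (2 / α) x) (C := ‖f‖ * C) hα ?_ (by positivity) ?_
  · intro x l hx hl hlx
    have hanti : ∀ᶠ n in atTop, Antitone (l n) := hl.mono fun n hn => (mem_partitions.1 hn).2
    exact ((f.continuous.tendsto x).comp hlx).mul (tendsto_jackWeight hα hanti hx hlx)
  · intro n hn l hl
    rw [abs_mul, abs_of_nonneg (jackWeight_nonneg hα hn l), mul_assoc]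
    exact mul_le_mul (f.norm_coe_le_norm _) (hle n hn l hl) (jackWeight_nonneg hα hn l)
      (norm_nonneg f)

theorem tendsto_integral_rescale :
    Tendsto (fun n => ∫ l, f (rescale (m + 1) α n l) ∂restricted (m + 1) α n) atTop
      (𝓝 (∫ x, f x ∂law (m + 1) (2 / α))) := by
  have hβ : 0 < 2 / α := by positivity
  have htotal := tendsto_mesh_pow_mul_sum_jackWeight hα
    (BoundedContinuousFunction.const (Fin (m + 1) → ℝ) (1 : ℝ))
  simp only [BoundedContinuousFunction.const_apply, one_mul] at htotal
  rw [integral_law hβ m f.continuous.measurable]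
  refine ((tendsto_mesh_pow_mul_sum_jackWeight hα f).div htotal
    (integral_weight_pos hβ m).ne').congr' ?_
  filter_upwards [eventually_gt_atTop 0] with n hn
  have hmesh := mesh_pos (d := m + 1) hα m.succ_pos hn
  rw [integral_restricted_eq_div hα m.succ_pos hn, Pi.div_apply,
    mul_div_mul_left _ _ (by positivity)]

end Limit

end JackMeasure

open scoped BoundedContinuousFunction in
lemma tendstoInDistribution_of_hasLaw {ι E Ω' : Type*} {S Ω : ι → Type*} {u : Filter ι}
    [∀ i, MeasurableSpace (S i)] [∀ i, MeasurableSpace (Ω i)] [MeasurableSpace Ω']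
    [TopologicalSpace E] [MeasurableSpace E] [OpensMeasurableSpace E]
    {μ : ∀ i, Measure (S i)} {ν : Measure E} {P : ∀ i, Measure (Ω i)} {Q : Measure Ω'}
    [∀ i, IsProbabilityMeasure (P i)] [IsProbabilityMeasure Q]
    {g : ∀ i, S i → E} (hg : ∀ i, Measurable (g i))
    (hlim : ∀ f : E →ᵇ ℝ, Tendsto (fun i => ∫ s, f (g i s) ∂μ i) u (𝓝 (∫ x, f x ∂ν)))
    {Y : ∀ i, Ω i → S i} (hY : ∀ i, HasLaw (Y i) (μ i) (P i)) {X : Ω' → E} (hX : HasLaw X ν Q) :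
    TendstoInDistribution (fun i ω => g i (Y i ω)) u X P Q := by
  have hgY : ∀ i, AEMeasurable (fun ω => g i (Y i ω)) (P i) := fun i =>
    (hg i).comp_aemeasurable (hY i).aemeasurable
  refine ⟨hgY, hX.aemeasurable,
    ProbabilityMeasure.tendsto_iff_forall_integral_tendsto.2 fun f => ?_⟩
  have hf := f.continuous.measurable
  simp only [ProbabilityMeasure.coe_mk, hX.map_eq]
  refine (hlim f).congr fun i => ?_
  rw [integral_map (hgY i) hf.aestronglyMeasurable]
  exact ((hY i).integral_comp (hf.comp (hg i)).aestronglyMeasurable).symm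

end

theorem theorem1 (d : ℕ) (hd : 0 < d) (α β : ℝ) (hα : 0 < α) (hβ : β = 2 / α) :
    (∀ n : ℕ, IsProbabilityMeasure (JackMeasure.restricted d α n)) ∧
    IsProbabilityMeasure (TracelessGBE.law d β) ∧
    ∀ (Ω : ℕ → Type*) [∀ n, MeasurableSpace (Ω n)]
      (P : ∀ n, Measure (Ω n)) [∀ n, IsProbabilityMeasure (P n)]
      (L : ∀ n, Ω n → Fin d → ℕ)
      (Ω' : Type*) [MeasurableSpace Ω'] (Q : Measure Ω') [IsProbabilityMeasure Q]
      (X : Ω' → Fin d → ℝ),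
      (∀ n, HasLaw (L n) (JackMeasure.restricted d α n) (P n)) →
      HasLaw X (TracelessGBE.law d β) Q →
      TendstoInDistribution (fun n ω => JackMeasure.rescale d α n (L n ω)) atTop X P Q := by
  subst hβ
  obtain ⟨m, rfl⟩ := Nat.exists_eq_succ_of_ne_zero hd.ne'
  refine ⟨JackMeasure.isProbabilityMeasure_restricted hα hd,
    TracelessGBE.isProbabilityMeasure_law (by positivity) m, ?_⟩
  intro Ω _ P _ L Ω' _ Q _ X hL hX
  exact tendstoInDistribution_of_hasLaw (fun n => measurable_of_countable _)
    (JackMeasure.tendsto_integral_rescale hα) hL hX
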